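/- **Calculus.** Fix a set of first-order values and a set of operations on them; first-order expressions $e,f$ are built from variables $x$, values $v$ and operations, so each closed expression evaluates to exactly one value. Let there be three disjoint countably infinite sets of names: higher-order names $a,b,c$, first-order names $h$, success names $\omega$. Processes are $$P ::= a(x,b).P \mid h(x).P \mid \overline a\langle e\rangle(b).P \mid \overline h\langle e\rangle.P \mid \omega.P \mid\ !a(x,b).P \mid\ !h(x).P \mid P|P \mid P+P \mid \nu a\,P \mid \nu h\,P \mid 0 \mid \mathbf{if}\ e=f\ \mathbf{then}\ P\ \mathbf{else}\ P,$$ where $x$ and $b$ are bound in the continuation of an input, $b$ is bound in the continuation of $\overline a\langle e\rangle(b)$, and $\nu$ binds. Everything is up to $\alpha$-conversion, and bound names are always chosen fresh. A process is closed if it has no free variables. The actions are $\tau$, $a\langle v\rangle(b)$, $\overline a\langle v\rangle(b)$ (with $b$ bound), $h\langle v\rangle$, $\overline h\langle v\rangle$, $\omega$. The transitions $P\xrightarrow{\mu}P'$ of closed processes are the usual ones of the internal $\pi$-calculus, early for values and late for the bound name: $a(x,b).P\xrightarrow{a\langle v\rangle(b)}P[v/x]$ and $h(x).P\xrightarrow{h\langle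 v\rangle}P[v/x]$ for every value $v$; $\overline a\langle e\rangle(b).P\xrightarrow{\overline a\langle v\rangle(b)}P$ and $\overline h\langle e\rangle.P\xrightarrow{\overline h\langle v\rangle}P$ if $e$ evaluates to $v$; $\omega.P\xrightarrow{\omega}0$; a synchronisation of $a\langle v\rangle(b)$ with $\overline a\langle v\rangle(b)$ gives $P|Q\xrightarrow{\tau}\nu b(P'|Q')$, and one of $h\langle v\rangle$ with $\overline h\langle v\rangle$ gives $P|Q\xrightarrow{\tau}P'|Q'$; if $\alpha.P\xrightarrow{\mu}Q$ for an input prefix $\alpha$ then $!\alpha.P\xrightarrow{\mu}Q\,|\,!\alpha.P$; the rules for parallel composition, sum, conditional and restriction are the standard ones. Write $P\Downarrow_\omega$ if $P$ can, after finitely many (possibly zero) $\tau$-transitions, reach a process that has an $\omega$-transition. **Visibility.** A visibility function $\Gamma$ is a partial function with finite domain from higher-order names and a token $\star$ to finite sets of higher-order names that is transitive: if $o,a\in\mathrm{dom}(\Gamma)$ and $a\in\Gamma(o)$ then $\Gamma(a)\subseteq\Gamma(o)$. Two visibility functions are compatible if $\star$ is not in both domains. $\Gamma\setminus p$ erases $p$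 from the domain and the codomain; $\Gamma, p\mapsto V$ extends $\Gamma$, for $p\notin\mathrm{dom}(\Gamma)$; $\Gamma_1\cup\Gamma_2$ is defined on the union of the domains, by the union of those values that are defined. The judgement $\Gamma\vdash P$ ($P$ is a $\Gamma$-process), for visibility functions $\Gamma$, is defined inductively by: - $\Gamma\vdash\overline a\langle e\rangle(b).P$ if $a\in\Gamma(\star)$ and $\Gamma\setminus\star,\ b\mapsto\Gamma(\star)\cup\{b\}\vdash P$; - $\Gamma\vdash a(x,b).P$ if $\star\notin\mathrm{dom}(\Gamma)$, $a\in\mathrm{dom}(\Gamma)$ and $\Gamma,\ \star\mapsto\Gamma(a)\cup\{b\}\vdash P$; - $\Gamma\vdash\overline h\langle e\rangle.P$ if $\star\notin\mathrm{dom}(\Gamma)$ and $\Gamma\vdash P$; $\Gamma\vdash h(x).P$ if $\star\in\mathrm{dom}(\Gamma)$ and $\Gamma\vdash P$; - $\Gamma\vdash\ !\alpha.P$ if $\star\notin\mathrm{dom}(\Gamma)$ and $\Gamma\vdash\alpha.P$; $\Gamma\vdash\omega.P$ always; $\Gamma\vdash 0$ if $\star\notin\mathrm{dom}(\Gamma)$;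 - $\Gamma\setminus a\vdash\nu a\,P$ if $\Gamma\vdash P$; $\Gamma\vdash\nu h\,P$ if $\Gamma\vdash P$; - $\Gamma\vdash P+Q$ and $\Gamma\vdash\mathbf{if}\ e=f\ \mathbf{then}\ P\ \mathbf{else}\ Q$ if $\Gamma\vdash P$ and $\Gamma\vdash Q$; - $\Gamma\vdash P|Q$ if $\Gamma=\Gamma_1\cup\Gamma_2$ for compatible visibility functions with $\Gamma_1\vdash P$ and $\Gamma_2\vdash Q$. **May testing.** Closed $\Delta$-processes $P,Q$ are may testing equivalent at $\Gamma$ if $\Delta,\Gamma$ are compatible and, for every closed $R$ with $\Gamma\vdash R$ and every success name $\omega$, $(R|P)\Downarrow_\omega$ iff $(R|Q)\Downarrow_\omega$. **Trace equivalence.** The type-allowed transitions $[\Gamma]P\xrightarrow{\mu}[\Gamma']P'$ are given, whenever $P\xrightarrow{\mu}P'$, by: - $\mu=\overline a\langle v\rangle(b)$, $a\in\mathrm{dom}(\Gamma)$, $\star\notin\mathrm{dom}(\Gamma)$, $\Gamma'=\Gamma,\ \star\mapsto\Gamma(a)\cup\{b\}$; - $\mu=a\langle v\rangle(b)$, $a\in\Gamma(\star)$,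 $\Gamma'=\Gamma\setminus\star,\ b\mapsto\Gamma(\star)\cup\{b\}$; - $\mu=\overline h\langle v\rangle$, $\star\in\mathrm{dom}(\Gamma)$, $\Gamma'=\Gamma$; - $\mu=h\langle v\rangle$ or $\mu=\tau$, $\star\notin\mathrm{dom}(\Gamma)$, $\Gamma'=\Gamma$. Weak transitions $[\Gamma]P\xRightarrow{\mu}[\Gamma']P'$, with $\mu\ne\tau$, allow any number of type-allowed $\tau$-transitions before and after $\mu$. A trace of $P$ under $\Gamma$ is a finite sequence $\mu_1\cdots\mu_n$ ($n\ge0$) of actions other than $\tau$ such that $[\Gamma]P\xRightarrow{\mu_1}\cdots\xRightarrow{\mu_n}[\Gamma_n]P_n$ for some $\Gamma_n,P_n$; its bound names are pairwise distinct and fresh (for the processes, for $\Gamma$ and for the free names of the trace), and traces are considered up to the choice of these names. Closed $\Delta$-processes $P,Q$ are trace equivalent at $\Gamma$ if $\Delta,\Gamma$ are compatible and $P,Q$ have the same traces under $\Gamma$. Both equivalences are extended to processes with free variables by requiring them under all closing substitutions of values for variables. **Theorem (characterisation of may testing using trace equivalence).** Let $\Delta,\Gamma$ be visibility functions and let $P,Q$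 be processes in which no success name occurs, with $\Delta\vdash P$ and $\Delta\vdash Q$. Then $P$ and $Q$ are trace equivalent at $\Gamma$ if and only if they are may testing equivalent at $\Gamma$. -/

import Mathlib

/-!
Internal pi-calculus with first-order values and success names, its visibility type system,
its labelled transition systems, may testing and typed trace equivalence.

Processes are taken up to alpha-conversion, by means of de Bruijn indices. Higher-order names,
first-order names and first-order variables are three separate families of indices. For the two
kinds of names an index that exceeds the number of enclosing binders of that kind denotes a free
name (so there are countably many free names of each kind); first-order variables are
well-scoped, so that `Proc S 0` is the type of closed processes.
-/

universe u v

namespace VisPi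

/-- First-order data: a set of first-order values and a set of operations on values, which are
the operations that first-order expressions may use. Nothing else is fixed about them. -/
structure FOLang where
  /-- first-order values -/
  Val : Type u
  /-- operation symbols -/
  Op : Type v
  /-- number of arguments of an operation -/
  arity : Op → ℕ
  /-- the function computed by an operation -/
  interp : (o : Op) → (Fin (arity o) → Val) → Val

variable {S : FOLang.{u, v}}

/-- First-order expressions with `n` free first-order variables. -/
inductive Expr (S : FOLang.{u, v}) (n : ℕ) : Type (max u v)
  | var (x : Fin n) : Expr S n
  | val (w : S.Val) : Expr S n
  | op (o : S.Op) (args : Fin (S.arity o) → Expr S n) : Expr S n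

/-- Simultaneous substitution of expressions for variables. -/
def Expr.subst {n m : ℕ} (σ : Fin n → Expr S m) : Expr S n → Expr S m
  | .var x => σ x
  | .val w => .val w
  | .op o args => .op o (fun i => (args i).subst σ)

/-- The value of an expression in an environment that gives values to its variables. -/
def Expr.evalIn {n : ℕ} (ρ : Fin n → S.Val) : Expr S n → S.Val
  | .var x => ρ x
  | .val w => w
  | .op o args => S.interp o (fun i => (args i).evalIn ρ)

/-- The value of a closed expression. -/
def Expr.eval (e : Expr S 0) : S.Val := e.evalIn Fin.elim0

/-- The substitution `σ` below the binder of one more variable (which gets index `0`). -/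
def liftSubst {n m : ℕ} (σ : Fin n → Expr S m) : Fin (n + 1) → Expr S (m + 1) :=
  Fin.cons (.var 0) (fun i => (σ i).subst (fun j => .var j.succ))

/-- Processes with `n` free first-order variables. The natural numbers in subject position are
higher-order names `a`, first-order names `h`, or success names `ω`.

* `inH a P` is `a(x,b).P`; it binds the variable `x` (variable index `0`) and the
  higher-order name `b` (higher-order index `0`) in `P`;
* `inF h P` is `h(x).P`; it binds the variable `x`;
* `outH a e P` outputs at `a` the value of `e` and a fresh higher-order name `b`, which it binds
  in `P`;
* `outF h e P` outputs the value of `e` at `h`;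
* `tick ω P` is `ω.P`;
* `repH a P` and `repF h P` are the replicated inputs `!a(x,b).P` and `!h(x).P`;
* `nuH P` and `nuF P` restrict a higher-order, respectively first-order, name;
* `ite e f P Q` is `if e = f then P else Q`. -/
inductive Proc (S : FOLang.{u, v}) : ℕ → Type (max u v)
  | nil {n : ℕ} : Proc S n
  | inH {n : ℕ} (a : ℕ) (P : Proc S (n + 1)) : Proc S n
  | inF {n : ℕ} (h : ℕ) (P : Proc S (n + 1)) : Proc S n
  | outH {n : ℕ} (a : ℕ) (e : Expr S n) (P : Proc S n) : Proc S n
  | outF {n : ℕ} (h : ℕ) (e : Expr S n) (P : Proc S n) : Proc S n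
  | tick {n : ℕ} (ω : ℕ) (P : Proc S n) : Proc S n
  | repH {n : ℕ} (a : ℕ) (P : Proc S (n + 1)) : Proc S n
  | repF {n : ℕ} (h : ℕ) (P : Proc S (n + 1)) : Proc S n
  | par {n : ℕ} (P Q : Proc S n) : Proc S n
  | sum {n : ℕ} (P Q : Proc S n) : Proc S n
  | nuH {n : ℕ} (P : Proc S n) : Proc S n
  | nuF {n : ℕ} (P : Proc S n) : Proc S n
  | ite {n : ℕ} (e f : Expr S n) (P Q : Proc S n) : Proc S n

/-- A renaming of higher-order names below one more binder. -/
def liftRen (r : ℕ → ℕ) : ℕ → ℕ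
  | 0 => 0
  | k + 1 => r k + 1

/-- The exchange of the two innermost higher-order names. -/
def swap01 : ℕ → ℕ
  | 0 => 1
  | 1 => 0
  | k + 2 => k + 2

/-- Capture-avoiding renaming of the free higher-order names. -/
def Proc.ren {n : ℕ} (r : ℕ → ℕ) : Proc S n → Proc S n
  | .nil => .nil
  | .inH a P => .inH (r a) (P.ren (liftRen r))
  | .inF h P => .inF h (P.ren r)
  | .outH a e P => .outH (r a) e (P.ren (liftRen r))
  | .outF h e P => .outF h e (P.ren r)
  | .tick ω P => .tick ω (P.ren r)
  | .repH a P => .repH (r a) (P.ren (liftRen r))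
  | .repF h P => .repF h (P.ren r)
  | .par P Q => .par (P.ren r) (Q.ren r)
  | .sum P Q => .sum (P.ren r) (Q.ren r)
  | .nuH P => .nuH (P.ren (liftRen r))
  | .nuF P => .nuF (P.ren r)
  | .ite e f P Q => .ite e f (P.ren r) (Q.ren r)

/-- Simultaneous substitution of expressions for the free first-order variables. Expressions
contain no names, so only variable binders matter. -/
def Proc.subst {n m : ℕ} (σ : Fin n → Expr S m) : Proc S n → Proc S m
  | .nil => .nil
  | .inH a P => .inH a (P.subst (liftSubst σ))
  | .inF h P => .inF h (P.subst (liftSubst σ))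
  | .outH a e P => .outH a (e.subst σ) (P.subst σ)
  | .outF h e P => .outF h (e.subst σ) (P.subst σ)
  | .tick ω P => .tick ω (P.subst σ)
  | .repH a P => .repH a (P.subst (liftSubst σ))
  | .repF h P => .repF h (P.subst (liftSubst σ))
  | .par P Q => .par (P.subst σ) (Q.subst σ)
  | .sum P Q => .sum (P.subst σ) (Q.subst σ)
  | .nuH P => .nuH (P.subst σ)
  | .nuF P => .nuF (P.subst σ)
  | .ite e f P Q => .ite (e.subst σ) (f.subst σ) (P.subst σ) (Q.subst σ)

/-- `P[w/x]` for a process whose only free variable is `x`. -/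
def Proc.inst (P : Proc S 1) (w : S.Val) : Proc S 0 := P.subst (fun _ => .val w)

/-- The closing substitution that replaces the free variables of `P` by values. -/
def Proc.close {n : ℕ} (P : Proc S n) (ρ : Fin n → S.Val) : Proc S 0 :=
  P.subst (fun i => .val (ρ i))

/-- No success name occurs in the process. -/
def Proc.TickFree {n : ℕ} : Proc S n → Prop
  | .nil => True
  | .inH _ P => P.TickFree
  | .inF _ P => P.TickFree
  | .outH _ _ P => P.TickFree
  | .outF _ _ P => P.TickFree
  | .tick _ _ => False
  | .repH _ P => P.TickFree
  | .repF _ P => P.TickFree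
  | .par P Q => P.TickFree ∧ Q.TickFree
  | .sum P Q => P.TickFree ∧ Q.TickFree
  | .nuH P => P.TickFree
  | .nuF P => P.TickFree
  | .ite _ _ P Q => P.TickFree ∧ Q.TickFree

/-! ### Untyped labelled transitions -/

/-- Actions. In `inH a w` and `outH a w` a higher-order name is also communicated; it is bound in
the action, and it is the higher-order index `0` of whatever comes after the action. -/
inductive Act (S : FOLang.{u, v}) : Type u
  | tau : Act S
  | inH (a : ℕ) (w : S.Val) : Act S
  | outH (a : ℕ) (w : S.Val) : Act S
  | inF (h : ℕ) (w : S.Val) : Act S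
  | outF (h : ℕ) (w : S.Val) : Act S
  | tick (ω : ℕ) : Act S

/-- Whether the action has a bound (higher-order) name. -/
def Act.binds : Act S → Bool
  | .inH _ _ => true
  | .outH _ _ => true
  | _ => false

/-- The same action seen from below one more restriction of a higher-order name; the actions in
the range of this map are those in which the restricted name does not occur free. -/
def Act.shiftH : Act S → Act S
  | .inH a w => .inH (a + 1) w
  | .outH a w => .outH (a + 1) w
  | μ => μ

/-- The same action seen from below one more restriction of a first-order name. -/
def Act.shiftF : Act S → Act S
  | .inF h w => .inF (h + 1) w
  | .outF h w => .outF (h + 1) w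
  | μ => μ

/-- A process that stays idle while another component performs `μ`: it is placed in the scope of
the bound name of `μ`, if there is one, and that name is fresh for it. -/
def Proc.idle {n : ℕ} (μ : Act S) (Q : Proc S n) : Proc S n :=
  if μ.binds then Q.ren Nat.succ else Q

/-- The restriction of a higher-order name in the residual `P` of an action `μ` from below that
restriction. If `μ` binds a name, that name (index `0` of `P`) moves out of the restriction
(whose name is index `1` of `P`). -/
def Proc.nuAfter {n : ℕ} (μ : Act S) (P : Proc S n) : Proc S n :=
  .nuH (if μ.binds then P.ren swap01 else P)

/-- The labelled transition system on closed processes, early for values and late for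
higher-order names. If `μ` binds a name then the residual has this name as index `0`. -/
inductive Step : Proc S 0 → Act S → Proc S 0 → Prop
  | inH (a : ℕ) (P : Proc S 1) (w : S.Val) : Step (.inH a P) (.inH a w) (P.inst w)
  | outH (a : ℕ) (e : Expr S 0) (P : Proc S 0) : Step (.outH a e P) (.outH a e.eval) P
  | inF (h : ℕ) (P : Proc S 1) (w : S.Val) : Step (.inF h P) (.inF h w) (P.inst w)
  | outF (h : ℕ) (e : Expr S 0) (P : Proc S 0) : Step (.outF h e P) (.outF h e.eval) P
  | tick (ω : ℕ) (P : Proc S 0) : Step (.tick ω P) (.tick ω) .nil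
  | repH {a : ℕ} {P : Proc S 1} {μ : Act S} {Q : Proc S 0} :
      Step (.inH a P) μ Q → Step (.repH a P) μ (.par Q ((Proc.repH a P).idle μ))
  | repF {h : ℕ} {P : Proc S 1} {μ : Act S} {Q : Proc S 0} :
      Step (.inF h P) μ Q → Step (.repF h P) μ (.par Q ((Proc.repF h P).idle μ))
  | nuH {P P' : Proc S 0} {μ : Act S} :
      Step P μ.shiftH P' → Step (.nuH P) μ (P'.nuAfter μ)
  | nuF {P P' : Proc S 0} {μ : Act S} :
      Step P μ.shiftF P' → Step (.nuF P) μ (.nuF P')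
  | sumL {P P' Q : Proc S 0} {μ : Act S} : Step P μ P' → Step (.sum P Q) μ P'
  | sumR {P Q Q' : Proc S 0} {μ : Act S} : Step Q μ Q' → Step (.sum P Q) μ Q'
  | parL {P P' Q : Proc S 0} {μ : Act S} :
      Step P μ P' → Step (.par P Q) μ (.par P' (Q.idle μ))
  | parR {P Q Q' : Proc S 0} {μ : Act S} :
      Step Q μ Q' → Step (.par P Q) μ (.par (P.idle μ) Q')
  | commHL {P P' Q Q' : Proc S 0} {a : ℕ} {w : S.Val} :
      Step P (.inH a w) P' → Step Q (.outH a w) Q' → Step (.par P Q) .tau (.nuH (.par P' Q'))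
  | commHR {P P' Q Q' : Proc S 0} {a : ℕ} {w : S.Val} :
      Step P (.outH a w) P' → Step Q (.inH a w) Q' → Step (.par P Q) .tau (.nuH (.par P' Q'))
  | commFL {P P' Q Q' : Proc S 0} {h : ℕ} {w : S.Val} :
      Step P (.inF h w) P' → Step Q (.outF h w) Q' → Step (.par P Q) .tau (.par P' Q')
  | commFR {P P' Q Q' : Proc S 0} {h : ℕ} {w : S.Val} :
      Step P (.outF h w) P' → Step Q (.inF h w) Q' → Step (.par P Q) .tau (.par P' Q')
  | iteT {e f : Expr S 0} {P Q P' : Proc S 0} {μ : Act S} :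
      e.eval = f.eval → Step P μ P' → Step (.ite e f P Q) μ P'
  | iteF {e f : Expr S 0} {P Q Q' : Proc S 0} {μ : Act S} :
      e.eval ≠ f.eval → Step Q μ Q' → Step (.ite e f P Q) μ Q'

/-- Zero or more reductions. -/
def Reduces : Proc S 0 → Proc S 0 → Prop :=
  Relation.ReflTransGen (fun P P' => Step P .tau P')

/-- The success `ω` is possible, after some reductions. -/
def Succeeds (P : Proc S 0) (ω : ℕ) : Prop :=
  ∃ P' P'', Reduces P P' ∧ Step P' (.tick ω) P''

/-! ### Visibility functions -/

/-- A partial function from the higher-order names and the token `cur` to finite sets of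
higher-order names; `none` means undefined. -/
@[ext] structure VFun where
  /-- the value at the token `cur` -/
  cur : Option (Finset ℕ)
  /-- the values at the higher-order names -/
  name : ℕ → Option (Finset ℕ)

/-- A visibility function: the domain is finite and the function is transitive. -/
structure VFun.IsVisibility (Γ : VFun) : Prop where
  finite_dom : {a | Γ.name a ≠ none}.Finite
  trans_cur : ∀ V a W, Γ.cur = some V → a ∈ V → Γ.name a = some W → W ⊆ V
  trans_name : ∀ c V a W, Γ.name c = some V → a ∈ V → Γ.name a = some W → W ⊆ V

/-- A finite set of higher-order names seen from below one more binder. -/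
def shiftSet (V : Finset ℕ) : Finset ℕ := V.image Nat.succ

/-- A visibility function seen from below one more binder of a higher-order name: the new name,
index `0`, does not occur in it. -/
def VFun.shift (Γ : VFun) : VFun where
  cur := Γ.cur.map shiftSet
  name := fun
    | 0 => none
    | a + 1 => (Γ.name a).map shiftSet

/-- The visibility below an output whose current visibility is `V`: the entry for `cur` is
erased, and the fresh name `b` (index `0`) is mapped to `V` together with `b`. -/
def VFun.afterOut (Γ : VFun) (V : Finset ℕ) : VFun where
  cur := none
  name := fun
    | 0 => some (insert 0 (shiftSet V))
    | a + 1 => (Γ.name a).map shiftSet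

/-- The visibility below an input at a name with visibility `V`: `cur` is mapped to `V` together
with the received fresh name `b` (index `0`). -/
def VFun.afterIn (Γ : VFun) (V : Finset ℕ) : VFun where
  cur := some (insert 0 (shiftSet V))
  name := fun
    | 0 => none
    | a + 1 => (Γ.name a).map shiftSet

/-- The higher-order name `a` is erased, both in the domain and in the codomain. -/
def VFun.erase (Γ : VFun) (a : ℕ) : VFun where
  cur := Γ.cur.map (fun V => V.erase a)
  name := fun b => if b = a then none else (Γ.name b).map (fun V => V.erase a)

/-- Union of two possibly undefined sets: defined as soon as one of the two is. -/
def optUnion : Option (Finset ℕ) → Option (Finset ℕ) → Option (Finset ℕ)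
  | none, W => W
  | some V, none => some V
  | some V, some W => some (V ∪ W)

/-- Union of partial functions. -/
def VFun.union (Γ₁ Γ₂ : VFun) : VFun where
  cur := optUnion Γ₁.cur Γ₂.cur
  name := fun a => optUnion (Γ₁.name a) (Γ₂.name a)

/-- Compatibility: at most one of the two functions is defined on `cur`. -/
def VFun.Compatible (Γ₁ Γ₂ : VFun) : Prop := Γ₁.cur = none ∨ Γ₂.cur = none

/-- The pair `(Γ₁, Γ₂)` of visibility functions belongs to `split Γ`. -/
def VFun.Split (Γ Γ₁ Γ₂ : VFun) : Prop :=
  Γ₁.IsVisibility ∧ Γ₂.IsVisibility ∧ Γ₁.union Γ₂ = Γ ∧ Γ₁.Compatible Γ₂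

/-! ### The type system for visibility -/

/-- `Typed Γ P` is the typing judgement `Γ ⊢ P`, for a visibility function `Γ`. (When `Γ` is a
visibility function, then so are all functions in a derivation of `Γ ⊢ P`: `afterOut` and
`afterIn`, as used here, preserve this property, and the rules `nuH` and `par` demand it of the
functions that they introduce.) -/
inductive Typed : {n : ℕ} → VFun → Proc S n → Prop
  | outH {n : ℕ} {Γ : VFun} {V : Finset ℕ} {a : ℕ} {e : Expr S n} {P : Proc S n} :
      Γ.cur = some V → a ∈ V → Typed (Γ.afterOut V) P → Typed Γ (.outH a e P)
  | inH {n : ℕ} {Γ : VFun} {V : Finset ℕ} {a : ℕ} {P : Proc S (n + 1)} :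
      Γ.cur = none → Γ.name a = some V → Typed (Γ.afterIn V) P → Typed Γ (.inH a P)
  | outF {n : ℕ} {Γ : VFun} {h : ℕ} {e : Expr S n} {P : Proc S n} :
      Γ.cur = none → Typed Γ P → Typed Γ (.outF h e P)
  | inF {n : ℕ} {Γ : VFun} {h : ℕ} {P : Proc S (n + 1)} :
      Γ.cur ≠ none → Typed Γ P → Typed Γ (.inF h P)
  | repH {n : ℕ} {Γ : VFun} {a : ℕ} {P : Proc S (n + 1)} :
      Γ.cur = none → Typed Γ (.inH a P) → Typed Γ (.repH a P)
  | repF {n : ℕ} {Γ : VFun} {h : ℕ} {P : Proc S (n + 1)} :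
      Γ.cur = none → Typed Γ (.inF h P) → Typed Γ (.repF h P)
  | tick {n : ℕ} {Γ : VFun} {ω : ℕ} {P : Proc S n} : Typed Γ (.tick ω P)
  | nuH {n : ℕ} {Γ Γ' : VFun} {P : Proc S n} :
      Γ'.IsVisibility → Γ'.erase 0 = Γ.shift → Typed Γ' P → Typed Γ (.nuH P)
  | nuF {n : ℕ} {Γ : VFun} {P : Proc S n} : Typed Γ P → Typed Γ (.nuF P)
  | nil {n : ℕ} {Γ : VFun} : Γ.cur = none → Typed Γ (.nil : Proc S n)
  | sum {n : ℕ} {Γ : VFun} {P Q : Proc S n} : Typed Γ P → Typed Γ Q → Typed Γ (.sum P Q)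
  | par {n : ℕ} {Γ Γ₁ Γ₂ : VFun} {P Q : Proc S n} :
      Γ.Split Γ₁ Γ₂ → Typed Γ₁ P → Typed Γ₂ Q → Typed Γ (.par P Q)
  | ite {n : ℕ} {Γ : VFun} {e f : Expr S n} {P Q : Proc S n} :
      Typed Γ P → Typed Γ Q → Typed Γ (.ite e f P Q)

/-! ### May testing -/

/-- May testing equivalence at `Γ` of `Δ`-processes `P` and `Q`. Processes with free first-order
variables are related when they are under all closing substitutions. -/
def MayEquiv {n : ℕ} (Δ Γ : VFun) (P Q : Proc S n) : Prop :=
  Δ.Compatible Γ ∧ ∀ (ρ : Fin n → S.Val) (R : Proc S 0), Typed Γ R → ∀ ω : ℕ,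
    (Succeeds (.par R (P.close ρ)) ω ↔ Succeeds (.par R (Q.close ρ)) ω)

/-! ### Typed transitions and typed trace equivalence -/

/-- Type-allowed transitions: `VStep Γ P μ Γ' P'` says that an observer with visibility `Γ`
allows `P` to perform `μ` and become `P'`, and then has visibility `Γ'`. The bound name of `μ`
becomes index `0`, both in `P'` and in `Γ'`, so it is fresh for `P` and `Γ`. -/
inductive VStep : VFun → Proc S 0 → Act S → VFun → Proc S 0 → Prop
  | outH {Γ : VFun} {P P' : Proc S 0} {a : ℕ} {w : S.Val} {V : Finset ℕ} :
      Step P (.outH a w) P' → Γ.name a = some V → Γ.cur = none →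
      VStep Γ P (.outH a w) (Γ.afterIn V) P'
  | inH {Γ : VFun} {P P' : Proc S 0} {a : ℕ} {w : S.Val} {V : Finset ℕ} :
      Step P (.inH a w) P' → Γ.cur = some V → a ∈ V →
      VStep Γ P (.inH a w) (Γ.afterOut V) P'
  | outF {Γ : VFun} {P P' : Proc S 0} {h : ℕ} {w : S.Val} :
      Step P (.outF h w) P' → Γ.cur ≠ none → VStep Γ P (.outF h w) Γ P'
  | inF {Γ : VFun} {P P' : Proc S 0} {h : ℕ} {w : S.Val} :
      Step P (.inF h w) P' → Γ.cur = none → VStep Γ P (.inF h w) Γ P'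
  | tau {Γ : VFun} {P P' : Proc S 0} :
      Step P .tau P' → Γ.cur = none → VStep Γ P .tau Γ P'

/-- Zero or more type-allowed reductions. -/
def VReduces (Γ : VFun) : Proc S 0 → Proc S 0 → Prop :=
  Relation.ReflTransGen (fun P P' => VStep Γ P .tau Γ P')

/-- Weak type-allowed transitions. -/
def WeakVStep (Γ : VFun) (P : Proc S 0) (μ : Act S) (Γ' : VFun) (P' : Proc S 0) : Prop :=
  ∃ P₁ P₂, VReduces Γ P P₁ ∧ VStep Γ P₁ μ Γ' P₂ ∧ VReduces Γ' P₂ P'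

/-- `IsTrace Γ P t`: the finite sequence `t` of interactions is a trace of `P` under visibility
`Γ`. Each bound name of `t` is index `0` for the rest of `t`; thus traces are taken up to the
choice of their bound names, and these are pairwise distinct and fresh. -/
inductive IsTrace : VFun → Proc S 0 → List (Act S) → Prop
  | nil {Γ : VFun} {P : Proc S 0} : IsTrace Γ P []
  | cons {Γ Γ' : VFun} {P P' : Proc S 0} {μ : Act S} {t : List (Act S)} :
      μ ≠ .tau → WeakVStep Γ P μ Γ' P' → IsTrace Γ' P' t → IsTrace Γ P (μ :: t)

/-- Typed trace equivalence at `Γ` of `Δ`-processes `P` and `Q`. Processes with free first-order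
variables are related when they are under all closing substitutions. -/
def TraceEquiv {n : ℕ} (Δ Γ : VFun) (P Q : Proc S n) : Prop :=
  Δ.Compatible Γ ∧ ∀ (ρ : Fin n → S.Val) (t : List (Act S)),
    (IsTrace Γ (P.close ρ) t ↔ IsTrace Γ (Q.close ρ) t)

end VisPi

/-! Success of a test factors through traces. `R | P` can signal `ω` if and only if `P` has, under
the visibility of `R`, a trace `t` whose dual interactions `R` can perform before signalling `ω`
(`Accepts R t ω`).

Composing a trace with an accepting test needs no typing (`Accepts.succeeds`). Decomposing a
successful run (`SucceedsIn.exists_trace`) needs typing, since each step of `P` has to be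
type-allowed. The token drives this: a reduction or a higher-order output of `P` requires `P` to
hold the token, and by compatibility the observer then lacks it; dually when `R` moves. The
conditions on names come from the typing of `R`. Subject reduction (`Typed.step`) keeps the
invariant, handing the token over at each communication between `R` and `P`. As `P` has no success
names, the final signal is from `R`. Hence inclusion of traces gives inclusion of successful tests.

Conversely, each trace `t` has a deterministic `tester`, typed because the side conditions of
type-allowed transitions are the typing premises of the dual prefixes. It reaches success `0` along
`t` and along no other sequence (`Accepts.eq_of_tester`), so passing this test forces `t` to be a
trace.

Subject reduction rests on stability of typing under renaming and enlargement of visibility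
(`Typed.ren`). The delicate case is restriction, where an entry for the restricted name has to be
added to a larger function without losing transitivity (`VFun.exists_erase_eq_shift`). -/

namespace VisPi

variable {S : FOLang.{u, v}}

/-! ### Membership view of visibility functions -/

/-- The value at a name or, for `none`, at the token. -/
def VFun.at (Γ : VFun) : Option ℕ → Option (Finset ℕ)
  | none => Γ.cur
  | some a => Γ.name a

/-- The function is defined at `o`. -/
def VFun.Dom (Γ : VFun) (o : Option ℕ) : Prop := Γ.at o ≠ none

/-- The name `a` belongs to the (defined) value at `o`. -/
def VFun.Mem (Γ : VFun) (o : Option ℕ) (a : ℕ) : Prop := ∃ V, Γ.at o = some V ∧ a ∈ V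

theorem VFun.Mem.dom {Γ : VFun} {o : Option ℕ} {a : ℕ} (h : Γ.Mem o a) : Γ.Dom o := by
  obtain ⟨V, hV, -⟩ := h
  simp [VFun.Dom, hV]

/-- Membership alone cannot tell the value `∅` from an undefined value, so domains are compared as
well. -/
theorem VFun.ext_mem {Γ Γ' : VFun} (hd : ∀ o, Γ.Dom o ↔ Γ'.Dom o)
    (hm : ∀ o a, Γ.Mem o a ↔ Γ'.Mem o a) : Γ = Γ' := by
  have key : ∀ o, Γ.at o = Γ'.at o := by
    intro o
    have h1 := hd o
    have h2 := hm o
    unfold VFun.Dom at h1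
    unfold VFun.Mem at h2
    rcases h : Γ.at o with _ | V <;> rcases h' : Γ'.at o with _ | V' <;> simp_all
    exact Finset.ext h2
  exact VFun.ext (key none) (funext fun a => key (some a))

theorem VFun.mem_none_of_eq {Γ : VFun} {V : Finset ℕ} (h : Γ.cur = some V) {a : ℕ} :
    Γ.Mem none a ↔ a ∈ V := by
  simp [VFun.Mem, VFun.at, h]

theorem VFun.mem_some_of_eq {Γ : VFun} {V : Finset ℕ} {c : ℕ} (h : Γ.name c = some V) {a : ℕ} :
    Γ.Mem (some c) a ↔ a ∈ V := by
  simp [VFun.Mem, VFun.at, h]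

theorem VFun.dom_none {Γ : VFun} : Γ.Dom none ↔ Γ.cur ≠ none := Iff.rfl

theorem VFun.dom_some {Γ : VFun} {a : ℕ} : Γ.Dom (some a) ↔ Γ.name a ≠ none := Iff.rfl

/-- Treating the token as one more point of the domain merges the two transitivity clauses into one.
-/
theorem VFun.isVisibility_iff {Γ : VFun} :
    Γ.IsVisibility ↔ {a | Γ.Dom (some a)}.Finite ∧
      ∀ o c a, Γ.Mem o c → Γ.Mem (some c) a → Γ.Mem o a := by
  constructor
  · rintro ⟨h1, h2, h3⟩
    refine ⟨h1, ?_⟩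
    rintro (_ | o) c a ⟨V, hV, hc⟩ ⟨W, hW, ha⟩
    · exact ⟨V, hV, h2 V c W hV hc hW ha⟩
    · exact ⟨V, hV, h3 o V c W hV hc hW ha⟩
  · rintro ⟨h1, h2⟩
    refine ⟨h1, fun V a W hV ha hW x hx => ?_, fun c V a W hV ha hW x hx => ?_⟩
    · exact (mem_none_of_eq hV).1 (h2 none a x ⟨V, hV, ha⟩ ⟨W, hW, hx⟩)
    · exact (mem_some_of_eq hV).1 (h2 (some c) a x ⟨V, hV, ha⟩ ⟨W, hW, hx⟩)

theorem VFun.IsVisibility.trans {Γ : VFun} (h : Γ.IsVisibility) {o : Option ℕ} {c a : ℕ} :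
    Γ.Mem o c → Γ.Mem (some c) a → Γ.Mem o a :=
  (VFun.isVisibility_iff.1 h).2 o c a

/-- The visibility function without its value at the token. -/
def VFun.passive (Γ : VFun) : VFun where
  cur := none
  name := Γ.name

section simp_lemmas

variable {Γ : VFun} {V : Finset ℕ} {a b c : ℕ} {o : Option ℕ}

@[simp] theorem zero_notMem_shiftSet : 0 ∉ shiftSet V := by simp [shiftSet]

@[simp] theorem succ_mem_shiftSet : a + 1 ∈ shiftSet V ↔ a ∈ V := by simp [shiftSet]

@[simp] theorem VFun.passive_cur : Γ.passive.cur = none := rfl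

@[simp] theorem VFun.dom_passive_none : ¬ Γ.passive.Dom none := by simp [VFun.dom_none]

@[simp] theorem VFun.dom_passive_some : Γ.passive.Dom (some a) ↔ Γ.Dom (some a) := Iff.rfl

@[simp] theorem VFun.mem_passive_none : ¬ Γ.passive.Mem none a := by
  simp [VFun.Mem, VFun.at]

@[simp] theorem VFun.mem_passive_some : Γ.passive.Mem (some c) a ↔ Γ.Mem (some c) a := Iff.rfl

@[simp] theorem VFun.dom_shift_none : Γ.shift.Dom none ↔ Γ.Dom none := by
  simp [VFun.Dom, VFun.at, VFun.shift]

@[simp] theorem VFun.dom_shift_zero : ¬ Γ.shift.Dom (some 0) := by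
  simp [VFun.Dom, VFun.at, VFun.shift]

@[simp] theorem VFun.dom_shift_succ : Γ.shift.Dom (some (a + 1)) ↔ Γ.Dom (some a) := by
  simp [VFun.Dom, VFun.at, VFun.shift]

@[simp] theorem VFun.not_mem_shift_zero : ¬ Γ.shift.Mem o 0 := by
  rcases o with _ | _ | b <;> simp [VFun.Mem, VFun.at, VFun.shift]

@[simp] theorem VFun.not_mem_shift_some_zero : ¬ Γ.shift.Mem (some 0) a := by
  simp [VFun.Mem, VFun.at, VFun.shift]

@[simp] theorem VFun.mem_shift_none : Γ.shift.Mem none (a + 1) ↔ Γ.Mem none a := by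
  simp [VFun.Mem, VFun.at, VFun.shift]

@[simp] theorem VFun.mem_shift_succ :
    Γ.shift.Mem (some (c + 1)) (a + 1) ↔ Γ.Mem (some c) a := by
  simp [VFun.Mem, VFun.at, VFun.shift]

@[simp] theorem VFun.dom_afterOut_none : ¬ (Γ.afterOut V).Dom none := by
  simp [VFun.Dom, VFun.at, VFun.afterOut]

@[simp] theorem VFun.dom_afterOut_zero : (Γ.afterOut V).Dom (some 0) := by
  simp [VFun.Dom, VFun.at, VFun.afterOut]

@[simp] theorem VFun.dom_afterOut_succ :
    (Γ.afterOut V).Dom (some (a + 1)) ↔ Γ.Dom (some a) := by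
  simp [VFun.Dom, VFun.at, VFun.afterOut]

@[simp] theorem VFun.mem_afterOut_none : ¬ (Γ.afterOut V).Mem none a := by
  simp [VFun.Mem, VFun.at, VFun.afterOut]

@[simp] theorem VFun.mem_afterOut_zero_zero : (Γ.afterOut V).Mem (some 0) 0 := by
  simp [VFun.Mem, VFun.at, VFun.afterOut]

@[simp] theorem VFun.mem_afterOut_zero_succ :
    (Γ.afterOut V).Mem (some 0) (a + 1) ↔ a ∈ V := by
  simp [VFun.Mem, VFun.at, VFun.afterOut]

@[simp] theorem VFun.mem_afterOut_succ_zero : ¬ (Γ.afterOut V).Mem (some (c + 1)) 0 := by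
  simp [VFun.Mem, VFun.at, VFun.afterOut]

@[simp] theorem VFun.mem_afterOut_succ_succ :
    (Γ.afterOut V).Mem (some (c + 1)) (a + 1) ↔ Γ.Mem (some c) a := by
  simp [VFun.Mem, VFun.at, VFun.afterOut]

@[simp] theorem VFun.dom_afterIn_none : (Γ.afterIn V).Dom none := by
  simp [VFun.Dom, VFun.at, VFun.afterIn]

@[simp] theorem VFun.dom_afterIn_zero : ¬ (Γ.afterIn V).Dom (some 0) := by
  simp [VFun.Dom, VFun.at, VFun.afterIn]

@[simp] theorem VFun.dom_afterIn_succ :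
    (Γ.afterIn V).Dom (some (a + 1)) ↔ Γ.Dom (some a) := by
  simp [VFun.Dom, VFun.at, VFun.afterIn]

@[simp] theorem VFun.mem_afterIn_none_zero : (Γ.afterIn V).Mem none 0 := by
  simp [VFun.Mem, VFun.at, VFun.afterIn]

@[simp] theorem VFun.mem_afterIn_none_succ : (Γ.afterIn V).Mem none (a + 1) ↔ a ∈ V := by
  simp [VFun.Mem, VFun.at, VFun.afterIn]

@[simp] theorem VFun.mem_afterIn_zero : ¬ (Γ.afterIn V).Mem (some 0) a := by
  simp [VFun.Mem, VFun.at, VFun.afterIn]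

@[simp] theorem VFun.mem_afterIn_succ_zero : ¬ (Γ.afterIn V).Mem (some (c + 1)) 0 := by
  simp [VFun.Mem, VFun.at, VFun.afterIn]

@[simp] theorem VFun.mem_afterIn_succ_succ :
    (Γ.afterIn V).Mem (some (c + 1)) (a + 1) ↔ Γ.Mem (some c) a := by
  simp [VFun.Mem, VFun.at, VFun.afterIn]

@[simp] theorem VFun.dom_erase : (Γ.erase b).Dom o ↔ o ≠ some b ∧ Γ.Dom o := by
  rcases o with _ | c
  · simp [VFun.Dom, VFun.at, VFun.erase]
  · by_cases h : c = b <;> simp [VFun.Dom, VFun.at, VFun.erase, h]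

@[simp] theorem VFun.mem_erase : (Γ.erase b).Mem o a ↔ o ≠ some b ∧ a ≠ b ∧ Γ.Mem o a := by
  rcases o with _ | c
  · simp only [VFun.Mem, VFun.at, VFun.erase]
    rcases Γ.cur with _ | W <;> simp
  · by_cases h : c = b
    · simp [VFun.Mem, VFun.at, VFun.erase, h]
    · simp only [VFun.Mem, VFun.at, VFun.erase, h]
      rcases Γ.name c with _ | W <;> simp [h]

end simp_lemmas

theorem finite_of_succ {p : ℕ → Prop} (h : {a | p (a + 1)}.Finite) : {a | p a}.Finite := by
  refine ((h.image Nat.succ).insert 0).subset ?_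
  rintro (_ | a) ha
  · simp
  · exact Or.inr ⟨a, ha, rfl⟩

theorem VFun.IsVisibility.passive {Γ : VFun} (h : Γ.IsVisibility) : Γ.passive.IsVisibility := by
  rw [VFun.isVisibility_iff] at h ⊢
  refine ⟨h.1, ?_⟩
  rintro (_ | o) c a <;> simp
  exact h.2 (some o) c a

theorem VFun.IsVisibility.shift {Γ : VFun} (h : Γ.IsVisibility) : Γ.shift.IsVisibility := by
  rw [VFun.isVisibility_iff] at h ⊢
  refine ⟨finite_of_succ (by simpa using h.1), ?_⟩
  rintro (_ | _ | o) (_ | c) (_ | a) <;> simp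
  · exact h.2 _ _ _
  · exact h.2 _ _ _

theorem VFun.IsVisibility.afterOut {Γ : VFun} {V : Finset ℕ} (h : Γ.IsVisibility)
    (hV : Γ.cur = some V) : (Γ.afterOut V).IsVisibility := by
  rw [VFun.isVisibility_iff] at h ⊢
  refine ⟨finite_of_succ (by simpa using h.1), ?_⟩
  rintro (_ | _ | o) (_ | c) (_ | a) <;> simp [← VFun.mem_none_of_eq hV]
  · exact h.2 _ _ _
  · exact h.2 _ _ _

theorem VFun.IsVisibility.afterIn {Γ : VFun} {V : Finset ℕ} {b : ℕ} (h : Γ.IsVisibility)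
    (hV : Γ.name b = some V) : (Γ.afterIn V).IsVisibility := by
  rw [VFun.isVisibility_iff] at h ⊢
  refine ⟨finite_of_succ (by simpa using h.1), ?_⟩
  rintro (_ | _ | o) (_ | c) (_ | a) <;> simp [← VFun.mem_some_of_eq hV]
  · exact h.2 _ _ _
  · exact h.2 _ _ _

/-! ### Renaming and weakening -/

/-- `Γ'` extends the image of `Γ` under the renaming `r`, and is defined at the token exactly if
`Γ` is. -/
structure VFun.RenLe (r : ℕ → ℕ) (Γ Γ' : VFun) : Prop where
  -- Names may be added freely but the token may not: `nil` and `outF` require its absence, `inF`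
  -- its presence.
  cur : Γ.Dom none ↔ Γ'.Dom none
  name : ∀ a, Γ.Dom (some a) → Γ'.Dom (some (r a))
  mem : ∀ o a, Γ.Mem o a → Γ'.Mem (o.map r) (r a)

section RenLe

variable {Γ Γ' : VFun} {V V' : Finset ℕ} {r : ℕ → ℕ} {b : ℕ}

theorem VFun.RenLe.shift (h : RenLe r Γ Γ') : RenLe (liftRen r) Γ.shift Γ'.shift := by
  refine ⟨by simpa using h.cur, ?_, ?_⟩
  · rintro (_ | a) <;> simp [liftRen]
    exact h.name a
  · rintro (_ | _ | o) (_ | a) <;> simp [liftRen]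
    · exact h.mem none a
    · exact h.mem (some o) a

theorem VFun.RenLe.passive (h : RenLe r Γ Γ') : RenLe r Γ.passive Γ'.passive := by
  refine ⟨by simp, h.name, ?_⟩
  rintro (_ | o) a <;> simp
  exact h.mem (some o) a

theorem VFun.RenLe.afterOut (h : RenLe r Γ Γ') (hV : Γ.cur = some V) (hV' : Γ'.cur = some V') :
    RenLe (liftRen r) (Γ.afterOut V) (Γ'.afterOut V') := by
  refine ⟨by simp, ?_, ?_⟩
  · rintro (_ | a) <;> simp [liftRen]
    exact h.name a
  · rintro (_ | _ | o) (_ | a) <;>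
      simp [liftRen, ← VFun.mem_none_of_eq hV, ← VFun.mem_none_of_eq hV']
    · exact h.mem none a
    · exact h.mem (some o) a

theorem VFun.RenLe.afterIn (h : RenLe r Γ Γ') (hV : Γ.name b = some V)
    (hV' : Γ'.name (r b) = some V') :
    RenLe (liftRen r) (Γ.afterIn V) (Γ'.afterIn V') := by
  refine ⟨by simp, ?_, ?_⟩
  · rintro (_ | a) <;> simp [liftRen]
    exact h.name a
  · rintro (_ | _ | o) (_ | a) <;>
      simp [liftRen, ← VFun.mem_some_of_eq hV, ← VFun.mem_some_of_eq hV']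
    · exact h.mem (some b) a
    · exact h.mem (some o) a

end RenLe

theorem VFun.dom_union {Γ₁ Γ₂ : VFun} {o : Option ℕ} :
    (Γ₁.union Γ₂).Dom o ↔ Γ₁.Dom o ∨ Γ₂.Dom o := by
  rcases o with _ | a
  · simp only [Dom, VFun.at, union]
    rcases Γ₁.cur with _ | V <;> rcases Γ₂.cur with _ | W <;> simp [optUnion]
  · simp only [Dom, VFun.at, union]
    rcases Γ₁.name a with _ | V <;> rcases Γ₂.name a with _ | W <;> simp [optUnion]

theorem VFun.mem_union {Γ₁ Γ₂ : VFun} {o : Option ℕ} {c : ℕ} :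
    (Γ₁.union Γ₂).Mem o c ↔ Γ₁.Mem o c ∨ Γ₂.Mem o c := by
  rcases o with _ | a
  · simp only [Mem, VFun.at, union]
    rcases Γ₁.cur with _ | V <;> rcases Γ₂.cur with _ | W <;> simp [optUnion]
  · simp only [Mem, VFun.at, union]
    rcases Γ₁.name a with _ | V <;> rcases Γ₂.name a with _ | W <;> simp [optUnion]

/-! ### Canonical splittings: names are shared, the token is not -/

theorem VFun.IsVisibility.split_left {Γ : VFun} (h : Γ.IsVisibility) :
    Γ.Split Γ Γ.passive := by
  refine ⟨h, h.passive, VFun.ext_mem ?_ ?_, Or.inr rfl⟩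
  · rintro (_ | a) <;> simp [VFun.dom_union]
  · rintro (_ | o) a <;> simp [VFun.mem_union]

theorem VFun.IsVisibility.split_right {Γ : VFun} (h : Γ.IsVisibility) :
    Γ.Split Γ.passive Γ := by
  refine ⟨h.passive, h, VFun.ext_mem ?_ ?_, Or.inl rfl⟩
  · rintro (_ | a) <;> simp [VFun.dom_union]
  · rintro (_ | o) a <;> simp [VFun.mem_union]

/-- Unions are monotone, so each component can be enlarged to the whole target, up to the token.
Compatibility leaves the token to one side and the other side fits into the passive part. Hence only
the two canonical splittings matter. -/
theorem VFun.Split.renLe {Γ Γ₁ Γ₂ Γ' : VFun} {r : ℕ → ℕ} (h : Γ.Split Γ₁ Γ₂)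
    (hr : RenLe r Γ Γ') :
    (RenLe r Γ₁ Γ' ∧ RenLe r Γ₂ Γ'.passive) ∨ (RenLe r Γ₁ Γ'.passive ∧ RenLe r Γ₂ Γ') := by
  obtain ⟨-, -, rfl, hc⟩ := h
  have hcur := hr.cur
  have hname := hr.name
  have hmem := hr.mem
  simp only [dom_union, mem_union] at hcur hname hmem
  have none_of : ∀ {Θ : VFun}, Θ.cur = none → ¬ Θ.Dom none ∧ ∀ a, ¬ Θ.Mem none a := by
    intro Θ h
    simp [Dom, Mem, VFun.at, h]
  rcases hc with hc | hc <;> obtain ⟨h1, h2⟩ := none_of hc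
  · right
    refine ⟨⟨by simp [h1], fun a ha => hname a (.inl ha), ?_⟩,
      ⟨by simpa [h1] using hcur, fun a ha => hname a (.inr ha), fun o a ha => hmem o a (.inr ha)⟩⟩
    rintro (_ | o) a ha
    · exact absurd ha (h2 a)
    · exact hmem (some o) a (.inl ha)
  · left
    refine ⟨⟨by simpa [h1] using hcur, fun a ha => hname a (.inl ha),
      fun o a ha => hmem o a (.inl ha)⟩, ⟨by simp [h1], fun a ha => hname a (.inr ha), ?_⟩⟩
    rintro (_ | o) a ha
    · exact absurd ha (h2 a)
    · exact hmem (some o) a (.inr ha)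

/-! ### Extending a visibility function by a restricted name -/

open Classical in
/-- A visibility function that extends `Ξ` by the name `0`, and in which this name plays
the role that `k` plays in `Θ`. -/
noncomputable def VFun.adjoin (Θ Ξ : VFun) (s : ℕ → ℕ) (k : ℕ) : VFun :=
  let sees : Option ℕ → Prop := fun o =>
    ∃ c, Θ.Mem c k ∧ (c.map s = o ∨ ∃ d, c = some d ∧ Ξ.Mem o (s d))
  let add : Option ℕ → Finset ℕ → Finset ℕ := fun o V => if sees o then insert 0 V else V
  { cur := Ξ.cur.map (add none)
    name := fun
      | 0 => (Θ.name k).map fun V =>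
          insert 0 (V.image s ∪ V.biUnion fun d => (Ξ.name (s d)).getD ∅)
      | a + 1 => (Ξ.name (a + 1)).map (add (some (a + 1))) }

section adjoin

variable {Θ Ξ : VFun} {s : ℕ → ℕ} {k : ℕ}

theorem VFun.dom_adjoin_zero : (Θ.adjoin Ξ s k).Dom (some 0) ↔ Θ.Dom (some k) := by
  simp [Dom, VFun.at, adjoin]

theorem VFun.dom_adjoin {o : Option ℕ} (ho : o ≠ some 0) :
    (Θ.adjoin Ξ s k).Dom o ↔ Ξ.Dom o := by
  rcases o with _ | _ | o <;> simp_all [Dom, VFun.at, adjoin]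

theorem VFun.mem_adjoin_zero {x : ℕ} : (Θ.adjoin Ξ s k).Mem (some 0) x ↔
    Θ.Dom (some k) ∧ (x = 0 ∨ (∃ d, Θ.Mem (some k) d ∧ s d = x) ∨
      ∃ d, Θ.Mem (some k) d ∧ Ξ.Mem (some (s d)) x) := by
  have aux : ∀ d, x ∈ (Ξ.name (s d)).getD ∅ ↔ Ξ.Mem (some (s d)) x := by
    intro d
    simp only [Mem, VFun.at]
    rcases Ξ.name (s d) with _ | V <;> simp
  simp only [← aux]
  simp only [Mem, Dom, VFun.at, adjoin]
  rcases Θ.name k with _ | V <;> simp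

open Classical in
theorem VFun.mem_adjoin {o : Option ℕ} (ho : o ≠ some 0) {x : ℕ} :
    (Θ.adjoin Ξ s k).Mem o x ↔ Ξ.Mem o x ∨ (x = 0 ∧ Ξ.Dom o ∧
      ∃ c, Θ.Mem c k ∧ (c.map s = o ∨ ∃ d, c = some d ∧ Ξ.Mem o (s d))) := by
  have aux : (Θ.adjoin Ξ s k).at o = (Ξ.at o).map fun V =>
      if ∃ c, Θ.Mem c k ∧ (c.map s = o ∨ ∃ d, c = some d ∧ Ξ.Mem o (s d))
      then insert 0 V else V := by
    rcases o with _ | _ | o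
    · rfl
    · exact absurd rfl ho
    · rfl
  constructor
  · rintro ⟨V', hV', hx⟩
    obtain ⟨V, hV, rfl⟩ := Option.map_eq_some_iff.1 (aux.symm.trans hV')
    split_ifs at hx with h
    · rcases Finset.mem_insert.1 hx with rfl | hx
      · exact .inr ⟨rfl, by simp [Dom, hV], h⟩
      · exact .inl ⟨V, hV, hx⟩
    · exact .inl ⟨V, hV, hx⟩
  · rintro (⟨V, hV, hx⟩ | ⟨rfl, hd, h⟩)
    · refine ⟨_, aux.trans (by rw [hV]; rfl), ?_⟩
      beta_reduce
      split_ifs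
      · exact Finset.mem_insert_of_mem hx
      · exact hx
    · obtain ⟨V, hV⟩ := Option.ne_none_iff_exists'.1 hd
      refine ⟨_, aux.trans (by rw [hV]; rfl), ?_⟩
      beta_reduce
      rw [if_pos h]
      exact Finset.mem_insert_self 0 V

/-- The added entries are the images of those of `k`, closed up by one transitivity step in
`Ξ.shift`. One step suffices because both `Θ` and `Ξ.shift` are already transitive. -/
theorem VFun.exists_erase_eq_shift (hΘ : Θ.IsVisibility) (hΞ : Ξ.IsVisibility)
    (hs : ∀ a, s a = 0 ↔ a = k) (h : RenLe s (Θ.erase k) Ξ.shift) :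
    ∃ Θ' : VFun, Θ'.IsVisibility ∧ Θ'.erase 0 = Ξ.shift ∧ RenLe s Θ Θ' := by
  have hsk : s k = 0 := (hs k).2 rfl
  have hX := hΞ.shift
  refine ⟨Θ.adjoin Ξ.shift s k, ?_, ?_, ?_⟩
  · rw [isVisibility_iff]
    constructor
    · refine finite_of_succ ?_
      simpa [dom_adjoin] using (isVisibility_iff.1 hΞ).1
    intro o c x
    -- If `o` sees the new name because of some `c` seeing `k`, then everything `k` sees must be
    -- visible from `o`. Transitivity of `Θ` gives it to `c`, `h` transports it, and `o` is the
    -- image of `c` or sees that image. The case `c = some k` is excluded since index `0` is absent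
    -- from `Ξ.shift`.
    have key : ∀ d, o ≠ some 0 → (∃ c, Θ.Mem c k ∧ (c.map s = o ∨
        ∃ d, c = some d ∧ Ξ.shift.Mem o (s d))) → Θ.Mem (some k) d → d ≠ k →
        Ξ.shift.Mem o (s d) := by
      rintro d ho ⟨c, hc, hco⟩ hd hdk
      have hck : c ≠ some k := by
        rintro rfl
        rcases hco with rfl | ⟨d, hd, hd'⟩
        · simp [hsk] at ho
        · cases hd
          simp [hsk] at hd'
      have h1 := h.mem c d (mem_erase.2 ⟨hck, hdk, hΘ.trans hc hd⟩)
      rcases hco with rfl | ⟨d', rfl, hd'⟩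
      · exact h1
      · exact hX.trans hd' h1
    by_cases ho : o = some 0
    · subst ho
      by_cases hc0 : c = 0
      · subst hc0
        exact fun _ h => h
      rw [mem_adjoin_zero, mem_adjoin_zero, mem_adjoin (by simpa using hc0)]
      rintro ⟨hd, hc⟩ (hx | ⟨rfl, -⟩)
      · refine ⟨hd, .inr (.inr ?_)⟩
        rcases hc with rfl | ⟨d, hd, rfl⟩ | ⟨d, hd, hc⟩
        · simp at hc0
        · exact ⟨d, hd, hx⟩
        · exact ⟨d, hd, hX.trans hc hx⟩
      · exact ⟨hd, .inl rfl⟩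
    rw [mem_adjoin ho, mem_adjoin ho]
    rintro (hc | ⟨rfl, hdo, hsee⟩)
    · have hc0 : c ≠ 0 := by
        rintro rfl
        simp at hc
      rw [mem_adjoin (by simpa using hc0)]
      rintro (hx | ⟨rfl, -, c', hc', hsee⟩)
      · exact .inl (hX.trans hc hx)
      · refine .inr ⟨rfl, hc.dom, c', hc', .inr ?_⟩
        rcases hsee with hsee | ⟨d, rfl, hd⟩
        · obtain ⟨d, rfl, rfl⟩ := Option.map_eq_some_iff.1 hsee
          exact ⟨d, rfl, hc⟩
        · exact ⟨d, rfl, hX.trans hc hd⟩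
    · rw [mem_adjoin_zero]
      rintro ⟨-, rfl | ⟨d, hd, rfl⟩ | ⟨d, hd, hx⟩⟩
      · exact .inr ⟨rfl, hdo, hsee⟩
      · by_cases hdk : d = k
        · exact .inr ⟨by rw [hdk, hsk], hdo, hsee⟩
        · exact .inl (key d ho hsee hd hdk)
      · have hdk : d ≠ k := by
          rintro rfl
          simp [hsk] at hx
        exact .inl (hX.trans (key d ho hsee hd hdk) hx)
  · refine ext_mem ?_ ?_
    · intro o
      rw [dom_erase]
      constructor
      · rintro ⟨h1, h2⟩
        exact (dom_adjoin h1).1 h2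
      · intro h2
        have h1 : o ≠ some 0 := by
          rintro rfl
          simp at h2
        exact ⟨h1, (dom_adjoin h1).2 h2⟩
    · intro o a
      rw [mem_erase]
      constructor
      · rintro ⟨h1, h2, h3⟩
        exact ((mem_adjoin h1).1 h3).resolve_right fun e => h2 e.1
      · intro h2
        have h1 : o ≠ some 0 := by
          rintro rfl
          simp at h2
        have h3 : a ≠ 0 := by
          rintro rfl
          simp at h2
        exact ⟨h1, h3, (mem_adjoin h1).2 (.inl h2)⟩
  · have hne : ∀ o : Option ℕ, o ≠ some k → o.map s ≠ some 0 := by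
      rintro (_ | o) ho <;> simp_all
    refine ⟨?_, ?_, ?_⟩
    · rw [dom_adjoin (by simp), ← h.cur]
      simp
    · intro a ha
      by_cases hak : a = k
      · subst hak
        rwa [hsk, dom_adjoin_zero]
      · rw [dom_adjoin (by simpa [hs] using hak)]
        exact h.name a (by simpa [hak] using ha)
    · intro o a ha
      by_cases hok : o = some k
      · subst hok
        rw [Option.map_some, hsk, mem_adjoin_zero]
        exact ⟨ha.dom, .inr (.inl ⟨a, ha, rfl⟩)⟩
      · rw [mem_adjoin (hne o hok)]
        by_cases hak : a = k
        · subst hak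
          refine .inr ⟨hsk, ?_, o, ha, .inl rfl⟩
          rcases o with _ | c
          · exact h.cur.1 (by simpa using ha.dom)
          · exact h.name c (by simpa using ⟨by simpa using hok, ha.dom⟩)
        · exact .inl (h.mem o a (mem_erase.2 ⟨hok, hak, ha⟩))

end adjoin

/-! ### Stability of typing under renaming, weakening and substitution -/

theorem Typed.ren {n : ℕ} {Γ : VFun} {P : Proc S n} (hP : Typed Γ P) :
    ∀ {r : ℕ → ℕ} {Γ' : VFun}, Γ'.IsVisibility → Γ.RenLe r Γ' → Typed Γ' (P.ren r) := by
  have none_of : ∀ {r : ℕ → ℕ} {Γ Γ' : VFun}, Γ.RenLe r Γ' → Γ.cur = none → Γ'.cur = none :=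
    fun h h' => by_contra fun h'' => h.cur.2 h'' h'
  induction hP with
  | outH hV ha _ ih =>
    intro r Γ' hΓ' h
    obtain ⟨V', hV', ha'⟩ := h.mem none _ ⟨_, hV, ha⟩
    exact .outH hV' ha' (ih (hΓ'.afterOut hV') (h.afterOut hV hV'))
  | @inH n Γ V a P hc hV _ ih =>
    intro r Γ' hΓ' h
    obtain ⟨V', hV'⟩ := Option.ne_none_iff_exists'.1
      (h.name a (by rw [VFun.dom_some, hV]; simp))
    exact .inH (none_of h hc) hV' (ih (hΓ'.afterIn hV') (h.afterIn hV hV'))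
  | outF hc _ ih => exact fun hΓ' h => .outF (none_of h hc) (ih hΓ' h)
  | inF hc _ ih => exact fun hΓ' h => .inF (h.cur.1 hc) (ih hΓ' h)
  | repH hc _ ih => exact fun hΓ' h => .repH (none_of h hc) (ih hΓ' h)
  | repF hc _ ih => exact fun hΓ' h => .repF (none_of h hc) (ih hΓ' h)
  | tick => exact fun _ _ => .tick
  | nuH hΘ he _ ih =>
    intro r Γ' hΓ' h
    obtain ⟨Θ', h1, h2, h3⟩ := VFun.exists_erase_eq_shift (s := liftRen r) (k := 0) hΘ hΓ'
      (by rintro (_ | a) <;> simp [liftRen]) (by rw [he]; exact h.shift)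
    exact .nuH h1 h2 (ih h1 h3)
  | nuF _ ih => exact fun hΓ' h => .nuF (ih hΓ' h)
  | nil hc => exact fun _ h => .nil (none_of h hc)
  | sum _ _ ih₁ ih₂ => exact fun hΓ' h => .sum (ih₁ hΓ' h) (ih₂ hΓ' h)
  | par hs _ _ ih₁ ih₂ =>
    intro r Γ' hΓ' h
    rcases hs.renLe h with ⟨h1, h2⟩ | ⟨h1, h2⟩
    · exact .par hΓ'.split_left (ih₁ hΓ' h1) (ih₂ hΓ'.passive h2)
    · exact .par hΓ'.split_right (ih₁ hΓ'.passive h1) (ih₂ hΓ' h2)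
  | ite _ _ ih₁ ih₂ => exact fun hΓ' h => .ite (ih₁ hΓ' h) (ih₂ hΓ' h)

theorem liftRen_id : liftRen id = id := by
  funext a
  cases a <;> rfl

theorem Proc.ren_id {n : ℕ} (P : Proc S n) : P.ren id = P := by
  induction P <;> simp_all [Proc.ren, liftRen_id]

theorem Typed.weaken {n : ℕ} {Γ Γ' : VFun} {P : Proc S n} (hP : Typed Γ P)
    (hΓ' : Γ'.IsVisibility) (h : Γ.RenLe id Γ') : Typed Γ' P := by
  simpa [Proc.ren_id] using hP.ren hΓ' h

/-- Meant for scope changes: with `s = swap01` and `k = 1`, the bound name of an action leaves the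
scope of the restriction. -/
theorem Typed.nuH_ren {n : ℕ} {Θ Ξ : VFun} {P : Proc S n} {s : ℕ → ℕ} {k : ℕ} (hP : Typed Θ P)
    (hΘ : Θ.IsVisibility) (hΞ : Ξ.IsVisibility) (hs : ∀ a, s a = 0 ↔ a = k)
    (h : (Θ.erase k).RenLe s Ξ.shift) : Typed Ξ (.nuH (P.ren s)) := by
  obtain ⟨Θ', h1, h2, h3⟩ := VFun.exists_erase_eq_shift hΘ hΞ hs h
  exact .nuH h1 h2 (hP.ren h1 h3)

theorem Typed.par_cases {n : ℕ} {Γ : VFun} {P Q : Proc S n} (h : Typed Γ (.par P Q))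
    (hΓ : Γ.IsVisibility) :
    (Typed Γ P ∧ Typed Γ.passive Q) ∨ (Typed Γ.passive P ∧ Typed Γ Q) := by
  cases h with
  | par hs hP hQ =>
    rcases hs.renLe (r := id) (Γ' := Γ) ⟨Iff.rfl, fun _ h => h, by simp⟩ with ⟨h1, h2⟩ | ⟨h1, h2⟩
    · exact .inl ⟨hP.weaken hΓ h1, hQ.weaken hΓ.passive h2⟩
    · exact .inr ⟨hP.weaken hΓ.passive h1, hQ.weaken hΓ h2⟩

theorem Typed.subst {n : ℕ} {Γ : VFun} {P : Proc S n} (hP : Typed Γ P) :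
    ∀ {m : ℕ} (σ : Fin n → Expr S m), Typed Γ (P.subst σ) := by
  induction hP with
  | outH hV ha _ ih => exact fun σ => .outH hV ha (ih _)
  | inH hc hV _ ih => exact fun σ => .inH hc hV (ih _)
  | outF hc _ ih => exact fun σ => .outF hc (ih _)
  | inF hc _ ih => exact fun σ => .inF hc (ih _)
  | repH hc _ ih => exact fun σ => .repH hc (ih _)
  | repF hc _ ih => exact fun σ => .repF hc (ih _)
  | tick => exact fun _ => .tick
  | nuH hΘ he _ ih => exact fun σ => .nuH hΘ he (ih _)
  | nuF _ ih => exact fun σ => .nuF (ih _)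
  | nil hc => exact fun _ => .nil hc
  | sum _ _ ih₁ ih₂ => exact fun σ => .sum (ih₁ _) (ih₂ _)
  | par hs _ _ ih₁ ih₂ => exact fun σ => .par hs (ih₁ _) (ih₂ _)
  | ite _ _ ih₁ ih₂ => exact fun σ => .ite (ih₁ _) (ih₂ _)

/-! ### Subject reduction -/

/-- The visibility function of the components of a process with current visibility `V` after an
internal communication, below the restriction of the communicated name. -/
def VFun.afterComm (Γ : VFun) (V : Finset ℕ) : VFun where
  cur := some (insert 0 (shiftSet V))
  name := (Γ.afterOut V).name

section afterComm

variable {Γ : VFun} {V : Finset ℕ}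

theorem VFun.passive_afterComm : (Γ.afterComm V).passive = Γ.afterOut V := rfl

@[simp] theorem VFun.dom_afterComm_none : (Γ.afterComm V).Dom none := by
  simp [VFun.Dom, VFun.at, VFun.afterComm]

@[simp] theorem VFun.dom_afterComm_some {c : ℕ} :
    (Γ.afterComm V).Dom (some c) ↔ (Γ.afterOut V).Dom (some c) := Iff.rfl

@[simp] theorem VFun.mem_afterComm_none {a : ℕ} :
    (Γ.afterComm V).Mem none a ↔ (Γ.afterIn V).Mem none a := Iff.rfl

@[simp] theorem VFun.mem_afterComm_some {c a : ℕ} :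
    (Γ.afterComm V).Mem (some c) a ↔ (Γ.afterOut V).Mem (some c) a := Iff.rfl

theorem VFun.IsVisibility.afterComm (h : Γ.IsVisibility) (hV : Γ.cur = some V) :
    (Γ.afterComm V).IsVisibility := by
  have h' := VFun.isVisibility_iff.1 (h.afterOut hV)
  refine VFun.isVisibility_iff.2 ⟨h'.1, ?_⟩
  rintro (_ | o) (_ | c) (_ | a)
  · simp
  · simp
  · simp
  · simpa [← VFun.mem_none_of_eq hV] using h.trans
  all_goals exact h'.2 (some o) _ _

theorem VFun.erase_afterComm (hV : Γ.cur = some V) : (Γ.afterComm V).erase 0 = Γ.shift := by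
  have hd : Γ.Dom none := by simp [VFun.dom_none, hV]
  refine VFun.ext_mem ?_ ?_
  · rintro (_ | _ | o) <;> simp [hd]
  · rintro (_ | _ | o) (_ | a) <;> simp [← VFun.mem_none_of_eq hV]

/-- The receiver is typed with current visibility `W` plus the new name, whereas the restricted
process keeps `V` plus that name. Since `a ∈ V`, transitivity gives `W ⊆ V`, and weakening closes
the gap. -/
theorem Typed.nuH_afterComm {n : ℕ} {W : Finset ℕ} {a : ℕ} {P Q : Proc S n} (hΓ : Γ.IsVisibility)
    (hV : Γ.cur = some V) (ha : a ∈ V) (hW : Γ.name a = some W)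
    (hP : Typed (Γ.passive.afterIn W) P) (hQ : Typed (Γ.afterOut V) Q) :
    Typed Γ (.nuH (.par P Q)) ∧ Typed Γ (.nuH (.par Q P)) := by
  have hΘ := hΓ.afterComm hV
  have hP' : Typed (Γ.afterComm V) P := by
    refine hP.weaken hΘ ⟨by simp, ?_, ?_⟩
    · rintro (_ | c) <;> simp
    · rintro (_ | _ | o) (_ | c) <;>
        simp [← VFun.mem_none_of_eq hV, ← VFun.mem_some_of_eq hW]
      exact hΓ.trans ((VFun.mem_none_of_eq hV).2 ha)
  rw [← VFun.passive_afterComm] at hQ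
  exact ⟨.nuH hΘ (VFun.erase_afterComm hV) (.par hΘ.split_left hP' hQ),
    .nuH hΘ (VFun.erase_afterComm hV) (.par hΘ.split_right hQ hP')⟩

end afterComm

/-- What the typing of a process in `Γ` says about its transition with action `μ` to `P`. -/
def AfterStep (Γ : VFun) (P : Proc S 0) : Act S → Prop
  -- Every synchronisation involves the token: the sender holds it on higher-order names, the
  -- receiver on first-order names.
  | .tau => Γ.cur ≠ none ∧ Typed Γ P
  -- If a parallel component already holds the token, the residual of an input may be untypable,
  -- since it would contain two holders.
  | .inH a _ => ∃ V, Γ.name a = some V ∧ (Γ.cur = none → Typed (Γ.afterIn V) P)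
  | .outH a _ => ∃ V, Γ.cur = some V ∧ a ∈ V ∧ Typed (Γ.afterOut V) P
  | .inF _ _ => Γ.cur ≠ none ∧ Typed Γ P
  | .outF _ _ => Γ.cur = none → Typed Γ P
  | .tick _ => True

theorem Typed.idle_afterOut {Γ : VFun} {V : Finset ℕ} {Q : Proc S 0} (hQ : Typed Γ.passive Q)
    (hΓ : Γ.IsVisibility) (hV : Γ.cur = some V) : Typed (Γ.afterOut V) (Q.ren Nat.succ) := by
  refine hQ.ren (hΓ.afterOut hV) ⟨by simp, ?_, ?_⟩
  · rintro a; simp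
  · rintro (_ | o) a <;> simp

theorem Typed.idle_afterIn {Γ : VFun} {V : Finset ℕ} {b : ℕ} {Q : Proc S 0}
    (hQ : Typed Γ.passive Q) (hΓ : Γ.IsVisibility) (hV : Γ.name b = some V) :
    Typed (Γ.afterIn V).passive (Q.ren Nat.succ) := by
  refine hQ.ren (hΓ.afterIn hV).passive ⟨by simp, ?_, ?_⟩
  · rintro a; simp
  · rintro (_ | o) a <;> simp

theorem VFun.passive_eq {Γ : VFun} (h : Γ.cur = none) : Γ.passive = Γ := by
  cases Γ
  simp_all [VFun.passive]

theorem Typed.passive {n : ℕ} {Γ : VFun} {P : Proc S n} (h : Γ.cur = none) (hP : Typed Γ P) :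
    Typed Γ.passive P := by
  rwa [VFun.passive_eq h]

theorem AfterStep.parL {Γ : VFun} {P Q : Proc S 0} {μ : Act S} (hΓ : Γ.IsVisibility)
    (hQ : Typed Γ.passive Q) (h : AfterStep Γ P μ) :
    AfterStep Γ (.par P (Q.idle μ)) μ ∧ AfterStep Γ (.par (Q.idle μ) P) μ := by
  cases μ with
  | tau => exact ⟨⟨h.1, .par hΓ.split_left h.2 hQ⟩, ⟨h.1, .par hΓ.split_right hQ h.2⟩⟩
  | inH a w =>
    obtain ⟨V, hV, hP⟩ := h
    have hQ' := hQ.idle_afterIn hΓ hV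
    have hΓ' := hΓ.afterIn hV
    exact ⟨⟨V, hV, fun hc => .par hΓ'.split_left (hP hc) hQ'⟩,
      ⟨V, hV, fun hc => .par hΓ'.split_right hQ' (hP hc)⟩⟩
  | outH a w =>
    obtain ⟨V, hV, ha, hP⟩ := h
    have hQ' := hQ.idle_afterOut hΓ hV
    have hΓ' := hΓ.afterOut hV
    have hp : (Γ.afterOut V).passive = Γ.afterOut V := rfl
    exact ⟨⟨V, hV, ha, .par hΓ'.split_left hP (hp ▸ hQ')⟩,
      ⟨V, hV, ha, .par hΓ'.split_right (hp ▸ hQ') hP⟩⟩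
  | inF a w => exact ⟨⟨h.1, .par hΓ.split_left h.2 hQ⟩, ⟨h.1, .par hΓ.split_right hQ h.2⟩⟩
  | outF a w =>
    exact ⟨fun hc => .par hΓ.split_left (h hc) hQ, fun hc => .par hΓ.split_right hQ (h hc)⟩
  | tick => exact ⟨trivial, trivial⟩

/-- Here the moving component lacks the token. Reductions, higher-order outputs and first-order
inputs are then impossible, and for the other actions nothing is claimed about the residual once `Γ`
holds the token. If `Γ` lacks it too, `AfterStep.parL` applies. -/
theorem AfterStep.parR {Γ : VFun} {P Q : Proc S 0} {μ : Act S} (hΓ : Γ.IsVisibility)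
    (hQ : Typed Γ Q) (h : AfterStep Γ.passive P μ) :
    AfterStep Γ (.par P (Q.idle μ)) μ ∧ AfterStep Γ (.par (Q.idle μ) P) μ := by
  by_cases hc : Γ.cur = none
  · rw [VFun.passive_eq hc] at h
    exact h.parL hΓ (by rwa [VFun.passive_eq hc])
  cases μ with
  | tau => exact absurd rfl h.1
  | inH a w =>
    obtain ⟨V, hV, -⟩ := h
    exact ⟨⟨V, hV, fun h => absurd h hc⟩, ⟨V, hV, fun h => absurd h hc⟩⟩
  | outH a w => exact absurd h.choose_spec.1 (by simp)
  | inF a w => exact absurd rfl h.1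
  | outF a w => exact ⟨fun h => absurd h hc, fun h => absurd h hc⟩
  | tick => exact ⟨trivial, trivial⟩

theorem AfterStep.nuH {Γ Γ' : VFun} {P : Proc S 0} {μ : Act S} (hΓ : Γ.IsVisibility)
    (hΓ' : Γ'.IsVisibility) (he : Γ'.erase 0 = Γ.shift) (h : AfterStep Γ' P μ.shiftH) :
    AfterStep Γ (P.nuAfter μ) μ := by
  -- The equation `he` says that `Γ'` and `Γ` agree away from the restricted name; it is read off
  -- pointwise.
  have hdn : Γ'.Dom none ↔ Γ.Dom none := by
    simpa using iff_of_eq (congrArg (fun Θ => VFun.Dom Θ none) he)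
  have hds : ∀ a, Γ'.Dom (some (a + 1)) ↔ Γ.Dom (some a) := fun a => by
    simpa using iff_of_eq (congrArg (fun Θ => VFun.Dom Θ (some (a + 1))) he)
  have hmn : ∀ a, Γ'.Mem none (a + 1) ↔ Γ.Mem none a := fun a => by
    simpa using iff_of_eq (congrArg (fun Θ => VFun.Mem Θ none (a + 1)) he)
  have hms : ∀ c a, Γ'.Mem (some (c + 1)) (a + 1) ↔ Γ.Mem (some c) a := fun c a => by
    simpa using iff_of_eq (congrArg (fun Θ => VFun.Mem Θ (some (c + 1)) (a + 1)) he)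
  have hcur : Γ.cur = none → Γ'.cur = none := fun h => by_contra fun h' => hdn.1 h' h
  cases μ with
  | tau => exact ⟨hdn.1 h.1, .nuH hΓ' he h.2⟩
  | inH a w =>
    obtain ⟨V', hV', hP⟩ := h
    obtain ⟨V, hV⟩ := Option.ne_none_iff_exists'.1
      ((hds a).1 (by rw [VFun.dom_some, hV']; simp))
    refine ⟨V, hV, fun hc => ?_⟩
    refine (hP (hcur hc)).nuH_ren (s := swap01) (k := 1) (hΓ'.afterIn hV') (hΓ.afterIn hV)
      (by rintro (_ | _ | a) <;> simp [swap01]) ⟨by simp, ?_, ?_⟩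
    · rintro (_ | _ | c) <;> simp [swap01, hds]
    · rintro (_ | _ | _ | o) (_ | _ | c) <;>
        simp [swap01, hms, ← VFun.mem_some_of_eq hV, ← VFun.mem_some_of_eq hV']
  | outH a w =>
    obtain ⟨V', hV', ha, hP⟩ := h
    obtain ⟨V, hV⟩ := Option.ne_none_iff_exists'.1
      (hdn.1 (by rw [VFun.dom_none, hV']; simp))
    refine ⟨V, hV, ?_, ?_⟩
    · rwa [← VFun.mem_none_of_eq hV, ← hmn, VFun.mem_none_of_eq hV']
    refine hP.nuH_ren (s := swap01) (k := 1) (hΓ'.afterOut hV') (hΓ.afterOut hV)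
      (by rintro (_ | _ | a) <;> simp [swap01]) ⟨by simp, ?_, ?_⟩
    · rintro (_ | _ | c) <;> simp [swap01, hds]
    · rintro (_ | _ | _ | o) (_ | _ | c) <;>
        simp [swap01, hms, hmn, ← VFun.mem_none_of_eq hV, ← VFun.mem_none_of_eq hV']
  | inF a w => exact ⟨hdn.1 h.1, .nuH hΓ' he h.2⟩
  | outF a w => exact fun hc => .nuH hΓ' he (h (hcur hc))
  | tick => trivial

theorem AfterStep.nuF {Γ : VFun} {P : Proc S 0} {μ : Act S} (h : AfterStep Γ P μ.shiftF) :
    AfterStep Γ (.nuF P) μ := by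
  cases μ with
  | tau => exact ⟨h.1, .nuF h.2⟩
  | inH a w => exact ⟨h.choose, h.choose_spec.1, fun hc => .nuF (h.choose_spec.2 hc)⟩
  | outH a w => exact ⟨h.choose, h.choose_spec.1, h.choose_spec.2.1, .nuF h.choose_spec.2.2⟩
  | inF a w => exact ⟨h.1, .nuF h.2⟩
  | outF a w => exact fun hc => .nuF (h hc)
  | tick => trivial

theorem AfterStep.commH {Γ Γ₁ Γ₂ : VFun} {P Q : Proc S 0} {a : ℕ} {w : S.Val}
    (hΓ : Γ.IsVisibility)
    (h : Γ₁ = Γ.passive ∧ Γ₂ = Γ ∨ Γ₁ = Γ ∧ Γ₂ = Γ.passive)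
    (hP : AfterStep Γ₁ P (.inH a w)) (hQ : AfterStep Γ₂ Q (.outH a w)) :
    AfterStep Γ (.nuH (.par P Q)) .tau ∧ AfterStep Γ (.nuH (.par Q P)) .tau := by
  obtain ⟨W, hW, hP⟩ := hP
  obtain ⟨V, hV, ha, hQ⟩ := hQ
  rcases h with ⟨rfl, rfl⟩ | ⟨rfl, rfl⟩
  · obtain ⟨h1, h2⟩ := Typed.nuH_afterComm hΓ hV ha hW (hP rfl) hQ
    exact ⟨⟨by simp [hV], h1⟩, ⟨by simp [hV], h2⟩⟩
  · simp at hV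

/-- Opposite to `AfterStep.commH`: on first-order names the token belongs to the receiver and stays
there. -/
theorem AfterStep.commF {Γ Γ₁ Γ₂ : VFun} {P Q : Proc S 0} {h : ℕ} {w : S.Val}
    (hΓ : Γ.IsVisibility)
    (hs : Γ₁ = Γ.passive ∧ Γ₂ = Γ ∨ Γ₁ = Γ ∧ Γ₂ = Γ.passive)
    (hP : AfterStep Γ₁ P (.inF h w)) (hQ : AfterStep Γ₂ Q (.outF h w)) :
    AfterStep Γ (.par P Q) .tau ∧ AfterStep Γ (.par Q P) .tau := by
  rcases hs with ⟨rfl, rfl⟩ | ⟨rfl, rfl⟩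
  · exact absurd rfl hP.1
  · exact ⟨⟨hP.1, .par hΓ.split_left hP.2 (hQ rfl)⟩, ⟨hP.1, .par hΓ.split_right (hQ rfl) hP.2⟩⟩

theorem Typed.step {P P' : Proc S 0} {μ : Act S} (h : Step P μ P') :
    ∀ {Γ : VFun}, Γ.IsVisibility → Typed Γ P → AfterStep Γ P' μ := by
  induction h with
  | inH a P w =>
    intro Γ _ ht
    cases ht with
    | inH _ hV hP => exact ⟨_, hV, fun _ => hP.subst _⟩
  | outH a e P =>
    intro Γ _ ht
    cases ht with
    | outH hV ha hP => exact ⟨_, hV, ha, hP⟩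
  | inF h P w =>
    intro Γ _ ht
    cases ht with
    | inF hc hP => exact ⟨hc, hP.subst _⟩
  | outF h e P =>
    intro Γ _ ht
    cases ht with
    | outF _ hP => exact fun _ => hP
  | tick ω P => exact fun _ _ => trivial
  | repH _ ih =>
    intro Γ hΓ ht
    cases ht with
    | repH hc hP => exact ((ih hΓ hP).parL hΓ (.passive hc (.repH hc hP))).1
  | repF _ ih =>
    intro Γ hΓ ht
    cases ht with
    | repF hc hP => exact ((ih hΓ hP).parL hΓ (.passive hc (.repF hc hP))).1
  | nuH _ ih =>
    intro Γ hΓ ht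
    cases ht with
    | nuH hΓ' he hP => exact (ih hΓ' hP).nuH hΓ hΓ' he
  | nuF _ ih =>
    intro Γ hΓ ht
    cases ht with
    | nuF hP => exact (ih hΓ hP).nuF
  | sumL _ ih =>
    intro Γ hΓ ht
    cases ht with
    | sum hP _ => exact ih hΓ hP
  | sumR _ ih =>
    intro Γ hΓ ht
    cases ht with
    | sum _ hQ => exact ih hΓ hQ
  | parL _ ih =>
    intro Γ hΓ ht
    rcases ht.par_cases hΓ with ⟨hP, hQ⟩ | ⟨hP, hQ⟩
    · exact ((ih hΓ hP).parL hΓ hQ).1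
    · exact ((ih hΓ.passive hP).parR hΓ hQ).1
  | parR _ ih =>
    intro Γ hΓ ht
    rcases ht.par_cases hΓ with ⟨hP, hQ⟩ | ⟨hP, hQ⟩
    · exact ((ih hΓ.passive hQ).parR hΓ hP).2
    · exact ((ih hΓ hQ).parL hΓ hP).2
  | commHL _ _ ih₁ ih₂ =>
    intro Γ hΓ ht
    rcases ht.par_cases hΓ with ⟨hP, hQ⟩ | ⟨hP, hQ⟩
    · exact (AfterStep.commH hΓ (.inr ⟨rfl, rfl⟩) (ih₁ hΓ hP) (ih₂ hΓ.passive hQ)).1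
    · exact (AfterStep.commH hΓ (.inl ⟨rfl, rfl⟩) (ih₁ hΓ.passive hP) (ih₂ hΓ hQ)).1
  | commHR _ _ ih₁ ih₂ =>
    intro Γ hΓ ht
    rcases ht.par_cases hΓ with ⟨hP, hQ⟩ | ⟨hP, hQ⟩
    · exact (AfterStep.commH hΓ (.inl ⟨rfl, rfl⟩) (ih₂ hΓ.passive hQ) (ih₁ hΓ hP)).2
    · exact (AfterStep.commH hΓ (.inr ⟨rfl, rfl⟩) (ih₂ hΓ hQ) (ih₁ hΓ.passive hP)).2
  | commFL _ _ ih₁ ih₂ =>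
    intro Γ hΓ ht
    rcases ht.par_cases hΓ with ⟨hP, hQ⟩ | ⟨hP, hQ⟩
    · exact (AfterStep.commF hΓ (.inr ⟨rfl, rfl⟩) (ih₁ hΓ hP) (ih₂ hΓ.passive hQ)).1
    · exact (AfterStep.commF hΓ (.inl ⟨rfl, rfl⟩) (ih₁ hΓ.passive hP) (ih₂ hΓ hQ)).1
  | commFR _ _ ih₁ ih₂ =>
    intro Γ hΓ ht
    rcases ht.par_cases hΓ with ⟨hP, hQ⟩ | ⟨hP, hQ⟩
    · exact (AfterStep.commF hΓ (.inl ⟨rfl, rfl⟩) (ih₂ hΓ.passive hQ) (ih₁ hΓ hP)).2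
    · exact (AfterStep.commF hΓ (.inr ⟨rfl, rfl⟩) (ih₂ hΓ hQ) (ih₁ hΓ.passive hP)).2
  | iteT _ _ ih =>
    intro Γ hΓ ht
    cases ht with
    | ite hP _ => exact ih hΓ hP
  | iteF _ _ ih =>
    intro Γ hΓ ht
    cases ht with
    | ite _ hQ => exact ih hΓ hQ

/-! ### Tests and traces -/

theorem Proc.TickFree.ren {n : ℕ} {P : Proc S n} (h : P.TickFree) (r : ℕ → ℕ) :
    (P.ren r).TickFree := by
  induction P generalizing r <;> simp_all [Proc.TickFree, Proc.ren]

theorem Proc.TickFree.subst {n m : ℕ} {P : Proc S n} (h : P.TickFree) (σ : Fin n → Expr S m) :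
    (P.subst σ).TickFree := by
  induction P generalizing m <;> simp_all [Proc.TickFree, Proc.subst]

theorem Proc.TickFree.idle {n : ℕ} {P : Proc S n} (h : P.TickFree) (μ : Act S) :
    (P.idle μ).TickFree := by
  unfold Proc.idle
  split_ifs
  exacts [h.ren _, h]

theorem Proc.TickFree.nuAfter {n : ℕ} {P : Proc S n} (h : P.TickFree) (μ : Act S) :
    (P.nuAfter μ).TickFree := by
  unfold Proc.nuAfter
  split_ifs
  exacts [h.ren _, h]

theorem Proc.TickFree.step {P P' : Proc S 0} {μ : Act S} (h : Step P μ P') (hP : P.TickFree) :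
    P'.TickFree := by
  induction h with
  | inH _ P | inF _ P => exact Proc.TickFree.subst (P := P) hP _
  | outH | outF => exact hP
  | tick => exact hP.elim
  | repH _ ih => exact ⟨ih hP, hP.idle (P := .repH _ _) _⟩
  | repF _ ih => exact ⟨ih hP, hP.idle (P := .repF _ _) _⟩
  | nuH _ ih => exact (ih hP).nuAfter _
  | nuF _ ih => exact ih hP
  | sumL _ ih => exact ih hP.1
  | sumR _ ih => exact ih hP.2
  | parL _ ih => exact ⟨ih hP.1, hP.2.idle _⟩
  | parR _ ih => exact ⟨hP.1.idle _, ih hP.2⟩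
  | commHL _ _ ih₁ ih₂ | commHR _ _ ih₁ ih₂ | commFL _ _ ih₁ ih₂ | commFR _ _ ih₁ ih₂ =>
    exact ⟨ih₁ hP.1, ih₂ hP.2⟩
  | iteT _ _ ih => exact ih hP.1
  | iteF _ _ ih => exact ih hP.2

theorem Proc.TickFree.not_step_tick {P P' : Proc S 0} {ω : ℕ} (hP : P.TickFree) :
    ¬ Step P (.tick ω) P' := by
  intro h
  generalize hμ : Act.tick ω = μ at h
  induction h with
  | inH | inF | outH | outF | commHL | commHR | commFL | commFR => cases hμ
  | tick => exact hP
  | repH _ ih | repF _ ih => exact ih hP hμ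
  | nuH _ ih | nuF _ ih =>
    subst hμ
    exact ih hP rfl
  | sumL _ ih | parL _ ih | iteT _ _ ih => exact ih hP.1 hμ
  | sumR _ ih | parR _ ih | iteF _ _ ih => exact ih hP.2 hμ

/-- The action with which the action `μ` synchronises. -/
def Act.dual : Act S → Option (Act S)
  | .inH a w => some (.outH a w)
  | .outH a w => some (.inH a w)
  | .inF h w => some (.outF h w)
  | .outF h w => some (.inF h w)
  | _ => none

/-- `R` can take part in the interactions `t`, seen from its environment, and then signal `ω`. -/
inductive Accepts : Proc S 0 → List (Act S) → ℕ → Prop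
  | tick {R R' : Proc S 0} {ω : ℕ} : Step R (.tick ω) R' → Accepts R [] ω
  | tau {R R' : Proc S 0} {t : List (Act S)} {ω : ℕ} :
      Step R .tau R' → Accepts R' t ω → Accepts R t ω
  | sync {R R' : Proc S 0} {μ ν : Act S} {t : List (Act S)} {ω : ℕ} :
      μ.dual = some ν → Step R ν R' → Accepts R' t ω → Accepts R (μ :: t) ω

/-- The success `ω` is possible after exactly `k` reductions. -/
def SucceedsIn : ℕ → Proc S 0 → ℕ → Prop
  | 0, P, ω => ∃ P', Step P (.tick ω) P'
  | k + 1, P, ω => ∃ P', Step P .tau P' ∧ SucceedsIn k P' ω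

/-! ### Composing and decomposing successful runs -/

theorem Succeeds.of_tick {P P' : Proc S 0} {ω : ℕ} (h : Step P (.tick ω) P') : Succeeds P ω :=
  ⟨P, P', .refl, h⟩

theorem Succeeds.of_tau {P P' : Proc S 0} {ω : ℕ} (h : Step P .tau P') (h' : Succeeds P' ω) :
    Succeeds P ω := by
  obtain ⟨P₁, P₂, h1, h2⟩ := h'
  exact ⟨P₁, P₂, .head h h1, h2⟩

theorem Succeeds.nuH {P : Proc S 0} {ω : ℕ} (h : Succeeds P ω) : Succeeds (.nuH P) ω := by
  obtain ⟨P₁, P₂, h1, h2⟩ := h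
  induction h1 using Relation.ReflTransGen.head_induction_on with
  | refl => exact .of_tick (.nuH h2)
  | head h _ ih => exact .of_tau (.nuH h) ih

theorem Succeeds.exists_succeedsIn {P : Proc S 0} {ω : ℕ} (h : Succeeds P ω) :
    ∃ k, SucceedsIn k P ω := by
  obtain ⟨P₁, P₂, h1, h2⟩ := h
  induction h1 using Relation.ReflTransGen.head_induction_on with
  | refl => exact ⟨0, P₂, h2⟩
  | head h _ ih =>
    obtain ⟨k, hk⟩ := ih
    exact ⟨k + 1, _, h, hk⟩

/-- Restriction affects neither reductions nor success signals. Removing it keeps the number of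
steps, so the induction on that number can continue below the binder left by a communication. -/
theorem SucceedsIn.of_nuH {P : Proc S 0} {k ω : ℕ} (h : SucceedsIn k (.nuH P) ω) :
    SucceedsIn k P ω := by
  induction k generalizing P with
  | zero =>
    obtain ⟨P', h⟩ := h
    cases h with
    | nuH h => exact ⟨_, h⟩
  | succ k ih =>
    obtain ⟨P', h, h'⟩ := h
    cases h with
    | nuH h => exact ⟨_, h, ih h'⟩

theorem VReduces.par_succeeds {Γ : VFun} {P P' R : Proc S 0} {ω : ℕ} (h : VReduces Γ P P')
    (h' : Succeeds (.par R P') ω) : Succeeds (.par R P) ω := by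
  induction h using Relation.ReflTransGen.head_induction_on with
  | refl => exact h'
  | head h _ ih =>
    cases h with
    | tau h _ => exact .of_tau (.parR h) ih

/-- A trace of `P` that is accepted by `R` leads `R | P` to success. -/
theorem Accepts.succeeds {R : Proc S 0} {t : List (Act S)} {ω : ℕ} (h : Accepts R t ω) :
    ∀ {Γ : VFun} {P : Proc S 0}, IsTrace Γ P t → Succeeds (.par R P) ω := by
  induction h with
  | tick h => exact fun _ => .of_tick (.parL h)
  | tau h _ ih => exact fun ht => .of_tau (.parL h) (ih ht)
  | sync hd h _ ih =>
    intro Γ P ht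
    cases ht with
    | cons hne hw ht =>
      obtain ⟨P₁, P₂, h1, h2, h3⟩ := hw
      refine h1.par_succeeds ?_
      have h4 := h3.par_succeeds (ih ht)
      cases h2 with
      | outH h' =>
        cases hd
        exact .of_tau (.commHL h h') h4.nuH
      | inH h' =>
        cases hd
        exact .of_tau (.commHR h h') h4.nuH
      | outF h' =>
        cases hd
        exact .of_tau (.commFL h h') h4
      | inF h' =>
        cases hd
        exact .of_tau (.commFR h h') h4
      | tau => exact absurd rfl hne

theorem IsTrace.cons_tau {Γ : VFun} {P P' : Proc S 0} {t : List (Act S)}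
    (h : VStep Γ P .tau Γ P') (ht : IsTrace Γ P' t) : IsTrace Γ P t := by
  cases ht with
  | nil => exact .nil
  | cons hne hw ht =>
    obtain ⟨P₁, P₂, h1, h2, h3⟩ := hw
    exact .cons hne ⟨P₁, P₂, .head h h1, h2, h3⟩ ht

theorem IsTrace.cons_step {Γ Γ' : VFun} {P P' : Proc S 0} {μ : Act S} {t : List (Act S)}
    (hμ : μ ≠ .tau) (h : VStep Γ P μ Γ' P') (ht : IsTrace Γ' P' t) : IsTrace Γ P (μ :: t) :=
  .cons hμ ⟨P, P', .refl, h, .refl⟩ ht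

/-- If a typed test `R` of `P` succeeds, then `P` has a trace that is accepted by `R`. -/
theorem SucceedsIn.exists_trace {k : ℕ} {Γ Δ : VFun} {P R : Proc S 0} {ω : ℕ}
    (hΓ : Γ.IsVisibility) (hΔ : Δ.IsVisibility) (hc : Δ.Compatible Γ) (hR : Typed Γ R)
    (hP : Typed Δ P) (hP' : P.TickFree) (h : SucceedsIn k (.par R P) ω) :
    ∃ t, IsTrace Γ P t ∧ Accepts R t ω := by
  induction k generalizing Γ Δ P R with
  | zero =>
    obtain ⟨X, h⟩ := h
    cases h with
    | parL h => exact ⟨[], .nil, .tick h⟩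
    | parR h => exact absurd h hP'.not_step_tick
  | succ k ih =>
    obtain ⟨X, h, hk⟩ := h
    cases h with
    | parL h =>
      obtain ⟨t, h1, h2⟩ := ih hΓ hΔ hc (Typed.step h hΓ hR).2 hP hP' hk
      exact ⟨t, h1, .tau h h2⟩
    | parR h =>
      -- A reduction shows that `P` holds the token, so the observer does not and the reduction is
      -- type-allowed.
      obtain ⟨hcur, hT⟩ := Typed.step h hΔ hP
      obtain ⟨t, h1, h2⟩ := ih hΓ hΔ hc hR hT (hP'.step h) hk
      exact ⟨t, h1.cons_tau (.tau h (hc.resolve_left hcur)), h2⟩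
    | commHL h h' =>
      obtain ⟨V, hV, -, hT'⟩ := Typed.step h' hΔ hP
      have hcur := hc.resolve_left (by simp [hV])
      obtain ⟨W, hW, hT⟩ := Typed.step h hΓ hR
      -- The token passes from `P` to `R`, so compatibility now holds on the side of `Δ`.
      obtain ⟨t, h1, h2⟩ := ih (hΓ.afterIn hW) (hΔ.afterOut hV) (.inl rfl) (hT hcur) hT'
        (hP'.step h') hk.of_nuH
      exact ⟨_, h1.cons_step (by simp) (.outH h' hW hcur), .sync rfl h h2⟩
    | commHR h h' =>
      obtain ⟨V, hV, ha, hT⟩ := Typed.step h hΓ hR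
      have hcur := hc.resolve_right (by simp [hV])
      obtain ⟨W, hW, hT'⟩ := Typed.step h' hΔ hP
      obtain ⟨t, h1, h2⟩ := ih (hΓ.afterOut hV) (hΔ.afterIn hW) (.inr rfl) hT (hT' hcur)
        (hP'.step h') hk.of_nuH
      exact ⟨_, h1.cons_step (by simp) (.inH h' hV ha), .sync rfl h h2⟩
    | commFL h h' =>
      obtain ⟨hcur, hT⟩ := Typed.step h hΓ hR
      have hT' := Typed.step h' hΔ hP (hc.resolve_right hcur)
      obtain ⟨t, h1, h2⟩ := ih hΓ hΔ hc hT hT' (hP'.step h') hk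
      exact ⟨_, h1.cons_step (by simp) (.outF h' hcur), .sync rfl h h2⟩
    | commFR h h' =>
      obtain ⟨hcur, hT'⟩ := Typed.step h' hΔ hP
      have hT := Typed.step h hΓ hR (hc.resolve_left hcur)
      obtain ⟨t, h1, h2⟩ := ih hΓ hΔ hc hT hT' (hP'.step h') hk
      exact ⟨_, h1.cons_step (by simp) (.inF h' (hc.resolve_left hcur)), .sync rfl h h2⟩

/-! ### The test for a trace -/

/-- The process that performs the duals of the actions of `t` and then signals `0`; it signals
`1` on receiving another value than the one in `t`. -/
def tester : List (Act S) → (n : ℕ) → Proc S n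
  | [], _ => .tick 0 .nil
  -- The failure branch cannot be `nil`: after an input the token is held and `nil` is untypable,
  -- while a success prefix is always typable. Its name `1` keeps it apart from the intended success
  -- `0`.
  | .outH a w :: t, n => .inH a (.ite (.var 0) (.val w) (tester t (n + 1)) (.tick 1 .nil))
  | .inH a w :: t, n => .outH a (.val w) (tester t n)
  | .outF h w :: t, n => .inF h (.ite (.var 0) (.val w) (tester t (n + 1)) (.tick 1 .nil))
  | .inF h w :: t, n => .outF h (.val w) (tester t n)
  -- Default values: neither action occurs in a trace, and `nil` accepts nothing.
  | .tau :: _, _ => .nil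
  | .tick _ :: _, _ => .nil

/-- The values of the trace are literals and the only variables are those bound by the input just
above, so a substitution merely changes the scope index. -/
theorem subst_tester (t : List (Act S)) {n m : ℕ} (σ : Fin n → Expr S m) :
    (tester t n).subst σ = tester t m := by
  induction t generalizing n m with
  | nil => rfl
  | cons μ t ih => cases μ <;> simp [tester, Proc.subst, Expr.subst, liftSubst, ih]

/-- The conditions under which an observer allows an action are those for typing the dual prefix,
and the visibility evolves in the same way. -/
theorem IsTrace.typed_tester {Γ : VFun} {P : Proc S 0} {t : List (Act S)} (h : IsTrace Γ P t) :
    ∀ n, Typed Γ (tester t n) := by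
  induction h with
  | nil => exact fun _ => .tick
  | cons hne hw _ ih =>
    intro n
    obtain ⟨P₁, P₂, -, h, -⟩ := hw
    cases h with
    | outH _ hV hc => exact .inH hc hV (.ite (ih _) .tick)
    | inH _ hV ha => exact .outH hV ha (ih _)
    | outF _ hc => exact .inF hc (.ite (ih _) .tick)
    | inF _ hc => exact .outF hc (ih _)
    | tau => exact absurd rfl hne

/-- The continuation of `tester` after the reception of `w'` where `w` is expected. -/
theorem inst_tester (t : List (Act S)) (w w' : S.Val) :
    (Proc.ite (.var 0) (.val w) (tester t 1) (.tick 1 .nil)).inst w' =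
      .ite (.val w') (.val w) (tester t 0) (.tick 1 .nil) := by
  simp [Proc.inst, Proc.subst, Expr.subst, subst_tester]

theorem Accepts.iteT {e f : Expr S 0} {P Q : Proc S 0} {t : List (Act S)} {ω : ℕ}
    (h : e.eval = f.eval) (hP : Accepts P t ω) : Accepts (.ite e f P Q) t ω := by
  cases hP with
  | tick hs => exact .tick (.iteT h hs)
  | tau hs ha => exact .tau (.iteT h hs) ha
  | sync hd hs ha => exact .sync hd (.iteT h hs) ha

theorem Accepts.of_ite {e f : Expr S 0} {P Q : Proc S 0} {t : List (Act S)} {ω : ℕ}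
    (h : Accepts (.ite e f P Q) t ω) :
    (e.eval = f.eval ∧ Accepts P t ω) ∨ Accepts Q t ω := by
  cases h with
  | tick hs =>
    cases hs with
    | iteT he hs => exact .inl ⟨he, .tick hs⟩
    | iteF _ hs => exact .inr (.tick hs)
  | tau hs ha =>
    cases hs with
    | iteT he hs => exact .inl ⟨he, .tau hs ha⟩
    | iteF _ hs => exact .inr (.tau hs ha)
  | sync hd hs ha =>
    cases hs with
    | iteT he hs => exact .inl ⟨he, .sync hd hs ha⟩
    | iteF _ hs => exact .inr (.sync hd hs ha)

theorem Accepts.of_tick {ω ω' : ℕ} {P : Proc S 0} {t : List (Act S)}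
    (h : Accepts (.tick ω P) t ω') : ω = ω' ∧ t = [] := by
  cases h with
  | tick hs =>
    cases hs
    exact ⟨rfl, rfl⟩
  | tau hs => cases hs
  | @sync _ _ μ _ _ _ hd hs =>
    cases hs
    cases μ <;> cases hd

theorem Accepts.of_inst_tester {t s : List (Act S)} {w w' : S.Val}
    (h : Accepts ((Proc.ite (.var 0) (.val w) (tester t 1) (.tick 1 .nil)).inst w') s 0) :
    w' = w ∧ Accepts (tester t 0) s 0 := by
  rw [inst_tester] at h
  rcases h.of_ite with h | h
  · exact h
  · exact absurd h.of_tick.1 one_ne_zero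

theorem IsTrace.accepts_tester {Γ : VFun} {P : Proc S 0} {t : List (Act S)}
    (h : IsTrace Γ P t) : Accepts (tester t 0) t 0 := by
  induction h with
  | nil => exact .tick (.tick 0 .nil)
  | cons hne hw _ ih =>
    obtain ⟨P₁, P₂, -, h, -⟩ := hw
    cases h with
    | outH => exact .sync rfl (.inH _ _ _) (by rw [inst_tester]; exact ih.iteT rfl)
    | inH => exact .sync rfl (.outH _ (.val _) _) ih
    | outF => exact .sync rfl (.inF _ _ _) (by rw [inst_tester]; exact ih.iteT rfl)
    | inF => exact .sync rfl (.outF _ (.val _) _) ih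
    | tau => exact absurd rfl hne

/-- The tester offers a single action at each point, apart from the choice of the received value. A
wrong value leads to a process that can only signal `1`, so success `0` determines the whole
sequence. -/
theorem Accepts.eq_of_tester {t s : List (Act S)} (h : Accepts (tester t 0) s 0) : s = t := by
  induction t generalizing s with
  | nil => exact h.of_tick.2
  | cons μ t ih =>
    cases μ with
    | tau | tick =>
      cases h with
      | tick hs | tau hs | sync _ hs => cases hs
    | outH | outF =>
      cases h with
      | tick hs | tau hs => cases hs
      | @sync _ _ ν _ _ _ hd hs ha =>
        cases hs
        obtain ⟨rfl, ha'⟩ := ha.of_inst_tester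
        cases ν <;> cases hd
        rw [ih ha']
    | inH | inF =>
      cases h with
      | tick hs | tau hs => cases hs
      | @sync _ _ ν _ _ _ hd hs ha =>
        cases hs
        cases ν <;> cases hd
        rw [ih ha]
        rfl

/-! ### The two inclusions -/

theorem Succeeds.exists_trace {Γ Δ : VFun} {P R : Proc S 0} {ω : ℕ}
    (hΓ : Γ.IsVisibility) (hΔ : Δ.IsVisibility) (hc : Δ.Compatible Γ) (hR : Typed Γ R)
    (hP : Typed Δ P) (hP' : P.TickFree) (h : Succeeds (.par R P) ω) :
    ∃ t, IsTrace Γ P t ∧ Accepts R t ω :=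
  let ⟨_, hk⟩ := h.exists_succeedsIn
  hk.exists_trace hΓ hΔ hc hR hP hP'

/-- Inclusion of traces implies inclusion of successful tests. -/
theorem Succeeds.of_traces {Γ Δ : VFun} {P Q R : Proc S 0} {ω : ℕ}
    (hΓ : Γ.IsVisibility) (hΔ : Δ.IsVisibility) (hc : Δ.Compatible Γ) (hR : Typed Γ R)
    (hP : Typed Δ P) (hP' : P.TickFree) (hPQ : ∀ t, IsTrace Γ P t → IsTrace Γ Q t)
    (h : Succeeds (.par R P) ω) : Succeeds (.par R Q) ω :=
  let ⟨_, ht, ha⟩ := h.exists_trace hΓ hΔ hc hR hP hP'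
  ha.succeeds (hPQ _ ht)

/-- Inclusion of successful tests implies inclusion of traces. -/
theorem IsTrace.of_tests {Γ Δ : VFun} {P Q : Proc S 0} {t : List (Act S)}
    (hΓ : Γ.IsVisibility) (hΔ : Δ.IsVisibility) (hc : Δ.Compatible Γ) (hQ : Typed Δ Q)
    (hQ' : Q.TickFree)
    (hPQ : ∀ R ω, Typed Γ R → Succeeds (.par R P) ω → Succeeds (.par R Q) ω)
    (h : IsTrace Γ P t) : IsTrace Γ Q t := by
  -- The tester of `t` succeeds against `P`, hence against `Q`, so it accepts some trace `s` of `Q`;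
  -- then `s = t`.
  obtain ⟨s, hs, ha⟩ := (hPQ _ 0 (h.typed_tester 0) (h.accepts_tester.succeeds h)).exists_trace
    hΓ hΔ hc (h.typed_tester 0) hQ hQ'
  rwa [← ha.eq_of_tester]

end VisPi

theorem mainTheorem1 {S : VisPi.FOLang.{u, v}} {n : ℕ} (Δ Γ : VisPi.VFun)
    (hΔ : Δ.IsVisibility) (hΓ : Γ.IsVisibility) (P Q : VisPi.Proc S n)
    (hP : VisPi.Typed Δ P) (hQ : VisPi.Typed Δ Q) (hP' : P.TickFree) (hQ' : Q.TickFree) :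
    VisPi.TraceEquiv Δ Γ P Q ↔ VisPi.MayEquiv Δ Γ P Q := by
  refine and_congr_right fun hc => forall_congr' fun ρ => ?_
  have hPρ : VisPi.Typed Δ (P.close ρ) := hP.subst _
  have hQρ : VisPi.Typed Δ (Q.close ρ) := hQ.subst _
  have hPρ' : (P.close ρ).TickFree := hP'.subst _
  have hQρ' : (Q.close ρ).TickFree := hQ'.subst _
  constructor
  · intro h R hR ω
    exact ⟨.of_traces hΓ hΔ hc hR hPρ hPρ' fun t => (h t).1,
      .of_traces hΓ hΔ hc hR hQρ hQρ' fun t => (h t).2⟩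
  · intro h t
    exact ⟨.of_tests hΓ hΔ hc hQρ hQρ' fun R ω hR => (h R hR ω).1,
      .of_tests hΓ hΔ hc hPρ hPρ' fun R ω hR => (h R hR ω).2⟩
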